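/- **Problem.** An instance of Envy Reducing Sharing Allocation (ERSA) consists of agents $a_1,\dots,a_n$, resources $\mathcal R=\{r_1,\dots,r_m\}$, a utility $u_i(r)\in\mathbb N_0$ for each agent $a_i$ and resource $r$ (extended additively to sets of resources), an initial complete allocation $\pi$ (pairwise disjoint bundles $\pi(a)\subseteq\mathcal R$ that cover $\mathcal R$), an undirected sharing graph $(\mathcal A,\mathcal E_s)$ and a loopless directed attention graph $(\mathcal A,\mathcal E_t)$ on the agents, and an integer $k\ge 0$. A *sharing* is a function $\delta\colon\mathcal E_s\to 2^{\mathcal R}$ with $\delta(\{a,b\})\subseteq\pi(a)\cup\pi(b)$ for all $\{a,b\}\in\mathcal E_s$; it gives agent $a$ the bundle $\Pi^\delta(a)=\pi(a)\cup\bigcup_{e\ni a}\delta(e)$. It is a *simple 2-sharing* if $\Pi^\delta(a)\cap\Pi^\delta(b)\cap\Pi^\delta(c)=\emptyset$ for any three distinct agents $a,b,c$, and $\bigl|\bigcup_{e\ni a}\delta(e)\bigr|\le 1$ for every agent $a$. Agent $a_i$ is *envious* under $\Pi^\delta$ if $u_i(\Pi^\delta(a_i))<u_i(\Pi^\delta(a_j))$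 for some $j$ with $(a_i,a_j)\in\mathcal E_t$. The question is whether there is a simple 2-sharing $\delta$ under which at most $k$ agents are envious. **Theorem.** There is an algorithm that decides every instance of ERSA and that, on instances with $n$ agents and $m\ge 1$ resources, runs in $O((2n)^n m^2)$ time. Moreover the same algorithm shows that ERSA is fixed-parameter tractable with respect to the number of agents: it runs in time at most $f(n)\cdot s^{d}$ on every instance whose binary encoding has length $s$, where $f$ is a computable function and $d$ is a constant. Here an algorithm is a program for a random access machine whose registers and array cells hold natural numbers, with unit cost for each constant, register or array access, addition, truncated subtraction, assignment and test for zero (there is no multiplication). The input is given by the numbers $n,m,k$ and by the row-major $n\times m$ matrices of the utilities and of the allocation (0-1) and the $n\times n$ adjacency matrices of the sharing graph and the attention graph. -/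

import Mathlib

/-! ## Envy Reducing Sharing Allocation -/

namespace ERSA

/-- An instance with agents `Fin n` and resources `Fin m`: additive utilities with values in `ℕ`,
an initial complete allocation, the undirected sharing graph, the directed loopless attention
graph, and the allowed number `k` of envious agents. -/
structure Instance (n m : ℕ) where
  /-- `util i r` is the utility of resource `r` for agent `i`. -/
  util : Fin n → Fin m → ℕ
  /-- The initial bundles. -/
  alloc : Fin n → Finset (Fin m)
  alloc_disjoint : ∀ i j, i ≠ j → Disjoint (alloc i) (alloc j)
  alloc_complete : ∀ r, ∃ i, r ∈ alloc i
  /-- The sharing graph. -/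
  share : SimpleGraph (Fin n)
  /-- The attention graph: `att.Adj i j` means that `i` looks at `j`. -/
  att : Digraph (Fin n)
  att_loopless : ∀ i, ¬ att.Adj i i
  /-- The allowed number of envious agents. -/
  k : ℕ

namespace Instance

variable {n m : ℕ} (I : Instance n m)

/-- A sharing assigns to every edge `{i, j}` of the sharing graph a set of resources that `i` or
`j` owns. -/
def IsSharing (δ : I.share.edgeSet → Finset (Fin m)) : Prop :=
  ∀ (i j : Fin n) (h : I.share.Adj i j), δ ⟨s(i, j), h⟩ ⊆ I.alloc i ∪ I.alloc j

open Classical in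
/-- The union of `δ e` over all edges `e` of the sharing graph that are incident with `a`. -/
noncomputable def sharedAt (δ : I.share.edgeSet → Finset (Fin m)) (a : Fin n) : Finset (Fin m) :=
  Finset.univ.filter fun r => ∃ e : I.share.edgeSet, a ∈ (e : Sym2 (Fin n)) ∧ r ∈ δ e

/-- The bundle of agent `a` in the sharing allocation induced by `δ`. -/
noncomputable def bundle (δ : I.share.edgeSet → Finset (Fin m)) (a : Fin n) : Finset (Fin m) :=
  I.alloc a ∪ I.sharedAt δ a

/-- A 2-sharing: no resource is in the bundles of three different agents. -/
def IsTwoSharing (δ : I.share.edgeSet → Finset (Fin m)) : Prop :=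
  I.IsSharing δ ∧ ∀ i j l : Fin n, i ≠ j → i ≠ l → j ≠ l →
    I.bundle δ i ∩ I.bundle δ j ∩ I.bundle δ l = ∅

/-- A `b`-bounded 2-sharing. -/
def IsBoundedTwoSharing (b : ℕ) (δ : I.share.edgeSet → Finset (Fin m)) : Prop :=
  I.IsTwoSharing δ ∧ ∀ a, (I.sharedAt δ a).card ≤ b

/-- A simple 2-sharing is a 1-bounded 2-sharing. -/
def IsSimpleTwoSharing (δ : I.share.edgeSet → Finset (Fin m)) : Prop :=
  I.IsBoundedTwoSharing 1 δ

/-- The value of a set of resources as perceived by agent `i`. -/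
def value (i : Fin n) (R : Finset (Fin m)) : ℕ := ∑ r ∈ R, I.util i r

/-- Agent `i` envies agent `j` under the sharing allocation induced by `δ`. -/
def Envies (δ : I.share.edgeSet → Finset (Fin m)) (i j : Fin n) : Prop :=
  I.value i (I.bundle δ i) < I.value i (I.bundle δ j) ∧ I.att.Adj i j

open Classical in
/-- The set of envious agents under the sharing allocation induced by `δ`. -/
noncomputable def envious (δ : I.share.edgeSet → Finset (Fin m)) : Finset (Fin n) :=
  Finset.univ.filter fun i => ∃ j, I.Envies δ i j

/-- The question asked: is there a simple 2-sharing with at most `k` envious agents? -/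
def IsYes : Prop := ∃ δ, I.IsSimpleTwoSharing δ ∧ (I.envious δ).card ≤ I.k

/-- The length of an instance in bits: the numbers `n`, `m`, `k` and the utilities in binary, each
with an end marker, and the 0-1 matrices of the allocation and of the two graphs. -/
def size : ℕ :=
  (n.size + 1) + (m.size + 1) + (I.k.size + 1) + (∑ i, ∑ r, ((I.util i r).size + 1))
    + n * m + n * n + n * n

end Instance

/-! ## Random access machines with structured control flow

A program works on registers and on arrays of unbounded length, which all hold natural numbers.
Registers and arrays are addressed by fixed numbers in the program text, so a program uses finitely
many of them; array cells are addressed by computed values (random access). Each constant, register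
access, array access, addition, truncated subtraction, assignment and test for zero takes one step.
There is no multiplication, so that the length of a number grows by at most one bit per step. -/

/-- The memory: registers and arrays. -/
structure Store where
  reg : ℕ → ℕ
  arr : ℕ → ℕ → ℕ

/-- Expressions. -/
inductive Expr where
  | const (c : ℕ)
  | reg (x : ℕ)
  /-- The cell of array `a` whose index is the value of `e`. -/
  | read (a : ℕ) (e : Expr)
  | add (e₁ e₂ : Expr)
  /-- Truncated subtraction. -/
  | sub (e₁ e₂ : Expr)

/-- The value of an expression. -/
def Expr.eval (s : Store) : Expr → ℕ
  | const c => c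
  | reg x => s.reg x
  | read a e => s.arr a (e.eval s)
  | add e₁ e₂ => e₁.eval s + e₂.eval s
  | sub e₁ e₂ => e₁.eval s - e₂.eval s

/-- The number of steps that the evaluation of an expression takes. -/
def Expr.cost : Expr → ℕ
  | const _ => 1
  | reg _ => 1
  | read _ e => e.cost + 1
  | add e₁ e₂ => e₁.cost + e₂.cost + 1
  | sub e₁ e₂ => e₁.cost + e₂.cost + 1

/-- Programs. -/
inductive Prog where
  | skip
  /-- Register `x` receives the value of `e`. -/
  | set (x : ℕ) (e : Expr)
  /-- The cell of array `a` at the value of `i` receives the value of `e`. -/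
  | write (a : ℕ) (i e : Expr)
  | seq (p q : Prog)
  /-- Run `p` if the value of `e` is not zero, and `q` otherwise. -/
  | branch (e : Expr) (p q : Prog)
  /-- Run `p` as long as the value of `e` is not zero. -/
  | loop (e : Expr) (p : Prog)

/-- The store after `set`. -/
def Store.setReg (s : Store) (x v : ℕ) : Store :=
  { s with reg := Function.update s.reg x v }

/-- The store after `write`. -/
def Store.setArr (s : Store) (a i v : ℕ) : Store :=
  { s with arr := Function.update s.arr a (Function.update (s.arr a) i v) }

/-- `Exec p s t s'`: program `p`, started in store `s`, halts after `t` steps in store `s'`. -/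
inductive Exec : Prog → Store → ℕ → Store → Prop where
  | skip (s : Store) : Exec Prog.skip s 1 s
  | set (s : Store) (x : ℕ) (e : Expr) :
      Exec (Prog.set x e) s (e.cost + 1) (s.setReg x (e.eval s))
  | write (s : Store) (a : ℕ) (i e : Expr) :
      Exec (Prog.write a i e) s (i.cost + e.cost + 1) (s.setArr a (i.eval s) (e.eval s))
  | seq {p q : Prog} {s s' s'' : Store} {t t' : ℕ} :
      Exec p s t s' → Exec q s' t' s'' → Exec (Prog.seq p q) s (t + t') s''
  | branch_true {e : Expr} {p q : Prog} {s s' : Store} {t : ℕ} :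
      e.eval s ≠ 0 → Exec p s t s' → Exec (Prog.branch e p q) s (e.cost + 1 + t) s'
  | branch_false {e : Expr} {p q : Prog} {s s' : Store} {t : ℕ} :
      e.eval s = 0 → Exec q s t s' → Exec (Prog.branch e p q) s (e.cost + 1 + t) s'
  | loop_stop {e : Expr} {p : Prog} {s : Store} :
      e.eval s = 0 → Exec (Prog.loop e p) s (e.cost + 1) s
  | loop_step {e : Expr} {p : Prog} {s s' s'' : Store} {t t' : ℕ} :
      e.eval s ≠ 0 → Exec p s t s' → Exec (Prog.loop e p) s' t' s'' →
      Exec (Prog.loop e p) s (e.cost + 1 + t + t') s''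

/-- Running time and result are determined by the program and the initial store. -/
theorem Exec.unique {p : Prog} {s : Store} {t₁ t₂ : ℕ} {s₁ s₂ : Store}
    (h₁ : Exec p s t₁ s₁) (h₂ : Exec p s t₂ s₂) : t₁ = t₂ ∧ s₁ = s₂ := by
  induction h₁ generalizing t₂ s₂ with
  | skip => cases h₂; exact ⟨rfl, rfl⟩
  | set => cases h₂; exact ⟨rfl, rfl⟩
  | write => cases h₂; exact ⟨rfl, rfl⟩
  | seq _ _ ih ih' =>
    cases h₂ with
    | seq a b =>
      obtain ⟨rfl, rfl⟩ := ih a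
      obtain ⟨rfl, rfl⟩ := ih' b
      exact ⟨rfl, rfl⟩
  | branch_true h _ ih =>
    cases h₂ with
    | branch_true _ a =>
      obtain ⟨rfl, rfl⟩ := ih a
      exact ⟨rfl, rfl⟩
    | branch_false h' _ => exact absurd h' h
  | branch_false h _ ih =>
    cases h₂ with
    | branch_true h' _ => exact absurd h h'
    | branch_false _ a =>
      obtain ⟨rfl, rfl⟩ := ih a
      exact ⟨rfl, rfl⟩
  | loop_stop h =>
    cases h₂ with
    | loop_stop => exact ⟨rfl, rfl⟩
    | loop_step h' => exact absurd h h'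
  | loop_step h _ _ ih ih' =>
    cases h₂ with
    | loop_stop h' => exact absurd h' h
    | loop_step _ a b =>
      obtain ⟨rfl, rfl⟩ := ih a
      obtain ⟨rfl, rfl⟩ := ih' b
      exact ⟨rfl, rfl⟩

/-! ## Solving instances by programs -/

/-- The entries of an `a × b` matrix in row-major order (entry `(i, j)` at index `i * b + j`),
followed by zeros. -/
def rowMajor {a b : ℕ} (f : Fin a → Fin b → ℕ) (x : ℕ) : ℕ :=
  if h : x < a * b then
    f (finProdFinEquiv.symm ⟨x, h⟩).1 (finProdFinEquiv.symm ⟨x, h⟩).2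
  else 0

open Classical in
/-- The initial store: registers 0, 1, 2 hold `n`, `m`, `k`; arrays 0, 1, 2, 3 hold, in row-major
order, the `n × m` utility matrix, the `n × m` 0-1 matrix of the initial allocation and the `n × n`
adjacency matrices of the sharing graph and of the attention graph; everything else is zero. -/
noncomputable def Instance.input {n m : ℕ} (I : Instance n m) : Store where
  reg
    | 0 => n
    | 1 => m
    | 2 => I.k
    | _ => 0
  arr
    | 0 => rowMajor I.util
    | 1 => rowMajor fun (i : Fin n) (r : Fin m) => if r ∈ I.alloc i then 1 else 0
    | 2 => rowMajor fun i j => if I.share.Adj i j then 1 else 0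
    | 3 => rowMajor fun i j => if I.att.Adj i j then 1 else 0
    | _ => fun _ => 0

/-- On input `I`, program `p` halts after exactly `t` steps with the correct answer in register 0:
one for yes, zero for no. -/
def Prog.Solves {n m : ℕ} (p : Prog) (I : Instance n m) (t : ℕ) : Prop :=
  ∃ s : Store, Exec p I.input t s ∧ (I.IsYes → s.reg 0 = 1) ∧ (¬ I.IsYes → s.reg 0 = 0)

end ERSA

/-! A simple 2-sharing is a matching in disguise. Since each agent meets at most one shared
resource, every agent is a giver, a receiver or idle, and each giver serves one receiver. So a
sharing amounts to a pairing `g` of receivers with givers along sharing edges, plus a pick `P` for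
some receivers among the resources of their givers (`isYes_of_pick`, `exists_pick_of_isYes`).

Guess the pairing and the set of agents that must not be envious. The picks are then found greedily:
every receiver takes a most valued resource that is still alive. Suppose that `Q` is a solution for
this guess that uses only alive resources. Under the greedy picks every agent values its own bundle
at least as much as under `Q`. Hence, if a protected agent envies `j`, then `Q` cannot give `j` its
greedy pick, and nobody else could receive that pick; it may be declared dead without harming `Q`
(`ne_of_pickEnvies`). For the right guess, a round with more than `k` envious agents kills at least
one resource, so `m + 1` rounds suffice (`Ready.rounds_complete`). A wrong guess does no harm,
because the answer is set only when the current picks are themselves a witness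
(`Ready.rounds_sound`).

The guesses are the vectors of a mixed radix counter. Each agent has a protection bit, a direction
bit and the distance to a partner of larger or equal index, which gives `2 ^ n * 2 ^ n * n!`
vectors. One guess costs `O((n + 1) ^ 2 * (m + 1) ^ 2)`. The quadratic factor in `n` disappears
because `2 ^ n * n!` is smaller than `n ^ n` by an exponential factor (`place_mul_sq_le`).

The program is written with counting loops only, so that its effect is a total function `run`, its
cost is bounded by recursion on the text, and invariants replace derivations of `Exec` (`run_rep`,
`exec_toProg`). -/

namespace ERSA

/-! ## Loop programs -/

/-- Programs whose only loops are counting loops. -/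
inductive LProg where
  | skip
  | set (x : ℕ) (e : Expr)
  | write (a : ℕ) (i e : Expr)
  | seq (p q : LProg)
  | branch (e : Expr) (p q : LProg)
  /-- Run `p` with register `x` taking the values `0, 1, …` below the value of register `b`. -/
  | rep (x b : ℕ) (p : LProg)

namespace LProg

/-- The translation of loop programs to programs. -/
def toProg : LProg → Prog
  | skip => .skip
  | set x e => .set x e
  | write a i e => .write a i e
  | seq p q => .seq p.toProg q.toProg
  | branch e p q => .branch e p.toProg q.toProg
  | rep x b p => .seq (.set x (.const 0))
      (.loop (.sub (.reg b) (.reg x)) (.seq p.toProg (.set x (.add (.reg x) (.const 1)))))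

/-- The store after a loop program. -/
def run : LProg → Store → Store
  | skip, s => s
  | set x e, s => s.setReg x (e.eval s)
  | write a i e, s => s.setArr a (i.eval s) (e.eval s)
  | seq p q, s => q.run (p.run s)
  | branch e p q, s => if e.eval s = 0 then q.run s else p.run s
  | rep x b p, s => Nat.rec (s.setReg x 0) (fun i t => (p.run t).setReg x (i + 1)) (s.reg b)

/-- The registers that a loop program may modify. -/
def modReg : LProg → List ℕ
  | skip => []
  | set x _ => [x]
  | write _ _ _ => []
  | seq p q => p.modReg ++ q.modReg
  | branch _ p q => p.modReg ++ q.modReg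
  | rep x _ p => x :: p.modReg

/-- The arrays that a loop program may modify. -/
def modArr : LProg → List ℕ
  | skip => []
  | set _ _ => []
  | write a _ _ => [a]
  | seq p q => p.modArr ++ q.modArr
  | branch _ p q => p.modArr ++ q.modArr
  | rep _ _ p => p.modArr

/-- The loop bounds are among the registers in `K`, and no loop body modifies its counter. -/
def Bounded (K : List ℕ) : LProg → Prop
  | skip => True
  | set _ _ => True
  | write _ _ _ => True
  | seq p q => p.Bounded K ∧ q.Bounded K
  | branch _ p q => p.Bounded K ∧ q.Bounded K
  | rep x b p => b ∈ K ∧ x ∉ p.modReg ∧ p.Bounded K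

instance decidableBounded (K : List ℕ) : (p : LProg) → Decidable (p.Bounded K)
  | skip => inferInstanceAs (Decidable True)
  | set _ _ => inferInstanceAs (Decidable True)
  | write _ _ _ => inferInstanceAs (Decidable True)
  | seq p q =>
    have := decidableBounded K p
    have := decidableBounded K q
    inferInstanceAs (Decidable (p.Bounded K ∧ q.Bounded K))
  | branch _ p q =>
    have := decidableBounded K p
    have := decidableBounded K q
    inferInstanceAs (Decidable (p.Bounded K ∧ q.Bounded K))
  | rep x b p =>
    have := decidableBounded K p
    inferInstanceAs (Decidable (b ∈ K ∧ x ∉ p.modReg ∧ p.Bounded K))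

/-- A bound for the running time when register `b` holds `v b` for every loop bound `b`. -/
def cost (v : ℕ → ℕ) : LProg → ℕ
  | skip => 1
  | set _ e => e.cost + 1
  | write _ i e => i.cost + e.cost + 1
  | seq p q => p.cost v + q.cost v
  | branch e p q => e.cost + 1 + (p.cost v + q.cost v)
  | rep _ b p => v b * (p.cost v + 8) + 6

theorem run_reg {p : LProg} {x : ℕ} (h : x ∉ p.modReg) (s : Store) :
    (p.run s).reg x = s.reg x := by
  induction p generalizing s with
  | skip => rfl
  | set y e =>
    simp only [modReg, List.mem_singleton] at h
    simp [run, Store.setReg, Function.update_of_ne h]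
  | write a i e => rfl
  | seq p q ihp ihq =>
    simp only [modReg, List.mem_append, not_or] at h
    simp only [run, ihp h.1, ihq h.2]
  | branch e p q ihp ihq =>
    simp only [modReg, List.mem_append, not_or] at h
    simp only [run]
    split_ifs
    · exact ihq h.2 s
    · exact ihp h.1 s
  | rep y b p ih =>
    simp only [modReg, List.mem_cons, not_or] at h
    simp only [run]
    induction s.reg b with
    | zero => simp [Store.setReg, Function.update_of_ne h.1]
    | succ k hk => simp only [Store.setReg, Function.update_of_ne h.1, ih h.2] at hk ⊢; exact hk

theorem run_arr {p : LProg} {a : ℕ} (h : a ∉ p.modArr) (s : Store) :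
    (p.run s).arr a = s.arr a := by
  induction p generalizing s with
  | skip => rfl
  | set y e => rfl
  | write b i e =>
    simp only [modArr, List.mem_singleton] at h
    simp [run, Store.setArr, Function.update_of_ne h]
  | seq p q ihp ihq =>
    simp only [modArr, List.mem_append, not_or] at h
    simp only [run, ihp h.1, ihq h.2]
  | branch e p q ihp ihq =>
    simp only [modArr, List.mem_append, not_or] at h
    simp only [run]
    split_ifs
    · exact ihq h.2 s
    · exact ihp h.1 s
  | rep y b p ih =>
    simp only [run]
    induction s.reg b with
    | zero => rfl
    | succ k hk => simp only [Store.setReg, ih h] at hk ⊢; exact hk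

/-- Two stores agree except on the registers and arrays that `p` may modify. -/
structure Frame (p : LProg) (s t : Store) : Prop where
  reg : ∀ x, x ∉ p.modReg → t.reg x = s.reg x
  arr : ∀ a, a ∉ p.modArr → t.arr a = s.arr a

theorem frame_run (p : LProg) (s : Store) : p.Frame s (p.run s) :=
  ⟨fun _ h => run_reg h s, fun _ h => run_arr h s⟩

/-- The invariant rule for counting loops. -/
theorem run_rep (x b : ℕ) (p : LProg) (s : Store) (P : ℕ → Store → Prop)
    (h0 : P 0 (s.setReg x 0))
    (hs : ∀ i t, i < s.reg b → (rep x b p).Frame s t → t.reg x = i → P i t →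
      P (i + 1) ((p.run t).setReg x (i + 1))) :
    P (s.reg b) ((rep x b p).run s) := by
  -- The frame condition and the value of the counter are carried along with `P`, so that invariants
  -- need not mention untouched memory.
  have key : ∀ k ≤ s.reg b,
      let t := Nat.rec (motive := fun _ => Store) (s.setReg x 0)
        (fun i t => (p.run t).setReg x (i + 1)) k
      (rep x b p).Frame s t ∧ t.reg x = k ∧ P k t := by
    intro k hk
    induction k with
    | zero =>
      refine ⟨⟨fun y hy => ?_, fun a _ => rfl⟩, by simp [Store.setReg], h0⟩
      simp only [modReg, List.mem_cons, not_or] at hy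
      simp [Store.setReg, Function.update_of_ne hy.1]
    | succ k ih =>
      obtain ⟨hf, hx, hp⟩ := ih (by omega)
      refine ⟨⟨fun y hy => ?_, fun a ha => ?_⟩, by simp [Store.setReg], hs k _ (by omega) hf hx hp⟩
      · have hy' := hy
        simp only [modReg, List.mem_cons, not_or] at hy
        simp only [Store.setReg, Function.update_of_ne hy.1]
        rw [run_reg hy.2]
        exact hf.reg y hy'
      · have ha' := ha
        simp only [modArr] at ha
        simp only [Store.setReg]
        rw [run_arr ha]
        exact hf.arr a ha'
  exact (key _ le_rfl).2.2

/-- The translation of a loop program computes its final store, within the bound `cost`. -/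
theorem exec_toProg (K : List ℕ) (v : ℕ → ℕ) (p : LProg) (hp : p.Bounded K)
    (hK : ∀ b ∈ K, b ∉ p.modReg) (s : Store) (hv : ∀ b ∈ K, s.reg b = v b) :
    ∃ t ≤ p.cost v, Exec p.toProg s t (p.run s) := by
  induction p generalizing s with
  | skip => exact ⟨_, le_rfl, .skip s⟩
  | set x e => exact ⟨_, le_rfl, .set s x e⟩
  | write a i e => exact ⟨_, le_rfl, .write s a i e⟩
  | seq p q ihp ihq =>
    simp only [modReg, List.mem_append, not_or] at hK
    obtain ⟨t, ht, h⟩ := ihp hp.1 (fun b hb => (hK b hb).1) s hv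
    obtain ⟨t', ht', h'⟩ := ihq hp.2 (fun b hb => (hK b hb).2) (p.run s)
      (fun b hb => by rw [run_reg (hK b hb).1, hv b hb])
    exact ⟨_, Nat.add_le_add ht ht', .seq h h'⟩
  | branch e p q ihp ihq =>
    simp only [modReg, List.mem_append, not_or] at hK
    simp only [cost, run]
    split_ifs with he
    · obtain ⟨t, ht, h⟩ := ihq hp.2 (fun b hb => (hK b hb).2) s hv
      exact ⟨_, by omega, .branch_false he h⟩
    · obtain ⟨t, ht, h⟩ := ihp hp.1 (fun b hb => (hK b hb).1) s hv
      exact ⟨_, by omega, .branch_true he h⟩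
  | rep x b p ih =>
    obtain ⟨hb, hx, hp⟩ := hp
    simp only [modReg, List.mem_cons, not_or] at hK
    have hbx : b ≠ x := (hK b hb).1
    set st : ℕ → Store := fun k => Nat.rec (motive := fun _ => Store) (s.setReg x 0)
      (fun i t => (p.run t).setReg x (i + 1)) k with hst
    have hsucc : ∀ k, st (k + 1) = (p.run (st k)).setReg x (k + 1) := fun k => rfl
    have hxk : ∀ k, (st k).reg x = k := by
      intro k
      cases k <;> simp [hst, Store.setReg]
    -- The compiled loop reads its bound anew at every test, whereas `run` reads it once; they agree
    -- because the bound registers never change.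
    have hKk : ∀ k, ∀ c ∈ K, (st k).reg c = v c := by
      intro k c hc
      induction k with
      | zero => simp [hst, Store.setReg, Function.update_of_ne (hK c hc).1, hv c hc]
      | succ k ihk =>
        rw [hsucc]
        simp only [Store.setReg, Function.update_of_ne (hK c hc).1]
        rw [run_reg (hK c hc).2, ihk]
    -- Here `d` is the number of iterations left. An iteration adds 4 steps for the test and 4 for
    -- the counter; the last 4 steps are the failing test.
    have hloop : ∀ d k, k + d = v b → ∃ t ≤ d * (p.cost v + 8) + 4,
        Exec (.loop (.sub (.reg b) (.reg x)) (.seq p.toProg (.set x (.add (.reg x) (.const 1)))))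
          (st k) t (st (v b)) := by
      intro d
      induction d with
      | zero =>
        intro k hk
        obtain rfl : k = v b := by omega
        refine ⟨_, ?_, Exec.loop_stop ?_⟩
        · simp [Expr.cost]
        · simp [Expr.eval, hxk, hKk _ b hb]
      | succ d ihd =>
        intro k hk
        obtain ⟨t, ht, h⟩ := ih hp (fun c hc => (hK c hc).2) (st k) (hKk k)
        obtain ⟨t', ht', h'⟩ := ihd (k + 1) (by omega)
        have hset : Exec (.set x (.add (.reg x) (.const 1))) (p.run (st k)) 4 (st (k + 1)) := by
          have := Exec.set (p.run (st k)) x (.add (.reg x) (.const 1))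
          simpa [Expr.cost, Expr.eval, run_reg hx, hxk, hsucc] using this
        refine ⟨_, ?_, .loop_step ?_ (.seq h hset) h'⟩
        · simp only [Expr.cost]
          rw [Nat.succ_mul]
          omega
        · simp only [Expr.eval, hxk, hKk k b hb]
          omega
    obtain ⟨t, ht, h⟩ := hloop (v b) 0 (by omega)
    have hrun : (rep x b p).run s = st (v b) := by simp only [run, hst, hv b hb]
    rw [hrun]
    refine ⟨_, ?_, Exec.seq (.set s x (.const 0)) h⟩
    simp only [cost, Expr.cost]
    omega

end LProg

namespace Instance

variable {n m : ℕ} (I : Instance n m)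

/-! ## Pairings and picks

A simple 2-sharing is given by a partial matching of givers and receivers, together with a resource
for some of the receivers. The number `g j` is `o + 1` if `j` receives from `o`, and zero if `j`
does not receive; the number `P j` is `r + 1` if `j` receives the resource `r`, and zero if `j`
receives nothing. -/

/-- `g` matches receivers with givers along edges of the sharing graph. -/
structure IsPairing (g : ℕ → ℕ) : Prop where
  le : ∀ j : Fin n, g j ≤ n
  adj : ∀ j o : Fin n, g j = o + 1 → I.share.Adj o j
  inj : ∀ j j' : Fin n, g j ≠ 0 → g j = g j' → j = j'
  giver : ∀ j o : Fin n, g j = o + 1 → g o = 0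

/-- The giver of `j` owns `r`. -/
def Offers (g : ℕ → ℕ) (j : Fin n) (r : Fin m) : Prop :=
  ∃ o : Fin n, g j = o + 1 ∧ r ∈ I.alloc o

/-- Every agent picks a resource of its giver, or nothing. -/
def IsLegal (g P : ℕ → ℕ) : Prop :=
  ∀ j : Fin n, P j = 0 ∨ ∃ r : Fin m, P j = r + 1 ∧ I.Offers g j r

/-- The bundle of `j` when the agents receive their picks. -/
def pickBundle (P : ℕ → ℕ) (j : Fin n) : Finset (Fin m) :=
  Finset.univ.filter fun r => r ∈ I.alloc j ∨ P j = r + 1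

/-- Agent `i` envies agent `j` when the agents receive their picks. -/
def PickEnvies (P : ℕ → ℕ) (i j : Fin n) : Prop :=
  I.value i (I.pickBundle P i) < I.value i (I.pickBundle P j) ∧ I.att.Adj i j

open Classical in
/-- The envious agents when the agents receive their picks. -/
noncomputable def pickEnvious (P : ℕ → ℕ) : Finset (Fin n) :=
  Finset.univ.filter fun i => ∃ j, I.PickEnvies P i j

variable {I}

theorem owner_unique {o o' : Fin n} {r : Fin m} (h : r ∈ I.alloc o) (h' : r ∈ I.alloc o') :
    o = o' := by
  by_contra hne
  exact Finset.disjoint_left.mp (I.alloc_disjoint o o' hne) h h'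

theorem mem_sharedAt {δ : I.share.edgeSet → Finset (Fin m)} {a : Fin n} {r : Fin m} :
    r ∈ I.sharedAt δ a ↔ ∃ e : I.share.edgeSet, a ∈ (e : Sym2 (Fin n)) ∧ r ∈ δ e := by
  simp [sharedAt]

theorem mem_pickEnvious {P : ℕ → ℕ} {i : Fin n} :
    i ∈ I.pickEnvious P ↔ ∃ j, I.PickEnvies P i j := by
  simp [pickEnvious]

theorem IsPairing.offers_unique {g : ℕ → ℕ} (hg : I.IsPairing g) {j j' : Fin n} {r : Fin m}
    (h : I.Offers g j r) (h' : I.Offers g j' r) : j = j' := by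
  obtain ⟨o, ho, hr⟩ := h
  obtain ⟨o', ho', hr'⟩ := h'
  obtain rfl := owner_unique hr hr'
  exact hg.inj j j' (by omega) (by omega)

theorem IsPairing.not_mem_of_offers {g : ℕ → ℕ} (hg : I.IsPairing g) {j : Fin n} {r : Fin m}
    (h : I.Offers g j r) : r ∉ I.alloc j := by
  obtain ⟨o, ho, hr⟩ := h
  intro hr'
  obtain rfl := owner_unique hr hr'
  exact I.share.loopless.irrefl _ (hg.adj _ _ ho)

-- The edge between a giver and its receiver carries the receiver's pick; all other edges carry
-- nothing. If three agents held one resource, two of them would own it or two would be offered it,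
-- and a pairing excludes both.
open Classical in
theorem isYes_of_pick {g P : ℕ → ℕ} (hg : I.IsPairing g) (hP : I.IsLegal g P)
    (hk : (I.pickEnvious P).card ≤ I.k) : I.IsYes := by
  let δ : I.share.edgeSet → Finset (Fin m) := fun e => Finset.univ.filter fun r =>
    ∃ o j : Fin n, (e : Sym2 (Fin n)) = s(o, j) ∧ g j = o + 1 ∧ r ∈ I.alloc o ∧ P j = r + 1
  have hmem : ∀ a r, r ∈ I.sharedAt δ a ↔
      ∃ o j : Fin n, (a = o ∨ a = j) ∧ g j = o + 1 ∧ r ∈ I.alloc o ∧ P j = r + 1 := by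
    intro a r
    rw [mem_sharedAt]
    constructor
    · rintro ⟨e, ha, hr⟩
      simp only [δ, Finset.mem_filter, Finset.mem_univ, true_and] at hr
      obtain ⟨o, j, he, h⟩ := hr
      rw [he, Sym2.mem_iff] at ha
      exact ⟨o, j, ha, h⟩
    · rintro ⟨o, j, ha, h⟩
      refine ⟨⟨s(o, j), hg.adj j o h.1⟩, Sym2.mem_iff.mpr ha, ?_⟩
      simp only [δ, Finset.mem_filter, Finset.mem_univ, true_and]
      exact ⟨o, j, rfl, h⟩
  have hbun : ∀ a, I.bundle δ a = I.pickBundle P a := by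
    intro a
    ext r
    simp only [bundle, pickBundle, Finset.mem_union, Finset.mem_filter, Finset.mem_univ, true_and,
      hmem]
    constructor
    · rintro (h | ⟨o, j, rfl | rfl, h1, h2, h3⟩)
      exacts [.inl h, .inl h2, .inr h3]
    · rintro (h | h)
      · exact .inl h
      · rcases hP a with h0 | ⟨r', hr', o, ho, hr⟩
        · omega
        · obtain rfl : r' = r := Fin.ext (by omega)
          exact .inr ⟨o, a, .inr rfl, ho, hr, h⟩
  have hshare : I.IsSharing δ := by
    intro i j h r hr
    simp only [δ, Finset.mem_filter, Finset.mem_univ, true_and] at hr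
    obtain ⟨o, j', he, -, hr, -⟩ := hr
    rw [Finset.mem_union]
    have : o = i ∨ o = j := by
      rw [← Sym2.mem_iff, he]
      exact Sym2.mem_mk_left _ _
    rcases this with rfl | rfl
    exacts [.inl hr, .inr hr]
  have hmembun : ∀ a r, r ∈ I.bundle δ a → r ∈ I.alloc a ∨ I.Offers g a r := by
    intro a r hr
    rw [hbun] at hr
    simp only [pickBundle, Finset.mem_filter, Finset.mem_univ, true_and] at hr
    rcases hr with h | h
    · exact .inl h
    · rcases hP a with h0 | ⟨r', hr', hr⟩
      · omega
      · obtain rfl : r' = r := Fin.ext (by omega)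
        exact .inr hr
  refine ⟨δ, ⟨⟨hshare, ?_⟩, ?_⟩, ?_⟩
  · intro i j l hij hil hjl
    by_contra hne
    obtain ⟨r, hr⟩ := Finset.nonempty_iff_ne_empty.mpr hne
    simp only [Finset.mem_inter] at hr
    obtain ⟨⟨hi, hj⟩, hl⟩ := hr
    rcases hmembun _ _ hi with hi | hi <;> rcases hmembun _ _ hj with hj | hj <;>
      rcases hmembun _ _ hl with hl | hl
    · exact hij (owner_unique hi hj)
    · exact hij (owner_unique hi hj)
    · exact hil (owner_unique hi hl)
    · exact hjl (hg.offers_unique hj hl)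
    · exact hjl (owner_unique hj hl)
    · exact hil (hg.offers_unique hi hl)
    · exact hij (hg.offers_unique hi hj)
    · exact hij (hg.offers_unique hi hj)
  · intro a
    rw [Finset.card_le_one]
    intro r hr r' hr'
    rw [hmem] at hr hr'
    obtain ⟨o, j, ha, h1, h2, h3⟩ := hr
    obtain ⟨o', j', ha', h1', h2', h3'⟩ := hr'
    have hj : j = j' := by
      -- Two transfers that touch the same agent coincide: a giver has one receiver, a receiver has
      -- one giver, and nobody is both.
      rcases ha with rfl | rfl <;> rcases ha' with rfl | rfl
      · exact hg.inj _ _ (by omega) (by omega)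
      · have := hg.giver _ _ h1
        omega
      · have := hg.giver _ _ h1'
        omega
      · rfl
    subst hj
    exact Fin.ext (by omega)
  · have : I.envious δ = I.pickEnvious P := by
      ext i
      rw [envious, pickEnvious, Finset.mem_filter, Finset.mem_filter]
      simp only [Envies, PickEnvies, hbun]
    rwa [this]

/-- A shared resource counts at both ends of its edge. Hence the bound 1 applies to givers as well
as receivers and forces the transfers to form a matching; that no resource reaches three agents
excludes two receivers of one giver. Resources that return to their owner change no bundle and are
dropped. -/
theorem exists_pick_of_isYes (h : I.IsYes) :
    ∃ g P : ℕ → ℕ, I.IsPairing g ∧ I.IsLegal g P ∧ (I.pickEnvious P).card ≤ I.k := by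
  classical
  obtain ⟨δ, ⟨⟨hs, h2⟩, h1⟩, hk⟩ := h
  -- `r` passes from `o` to `j`
  let G : Fin n → Fin n → Fin m → Prop := fun o j r => r ∈ I.alloc o ∧ o ≠ j ∧ r ∈ I.sharedAt δ j
  have hone : ∀ {a r r'}, r ∈ I.sharedAt δ a → r' ∈ I.sharedAt δ a → r = r' := fun hr hr' =>
    Finset.card_le_one.mp (h1 _) _ hr _ hr'
  have hedge : ∀ {o j r}, G o j r → I.share.Adj o j ∧ r ∈ I.sharedAt δ o := by
    rintro o j r ⟨hr, hne, hrs⟩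
    obtain ⟨⟨e, he⟩, hj, hre⟩ := mem_sharedAt.mp hrs
    obtain ⟨b, rfl⟩ := Sym2.mem_iff_exists.mp hj
    have hadj : I.share.Adj j b := he
    rcases Finset.mem_union.mp (hs j b hadj hre) with h | h
    · exact absurd (owner_unique hr h) hne
    · obtain rfl := owner_unique hr h
      exact ⟨hadj.symm, mem_sharedAt.mpr ⟨⟨_, he⟩, Sym2.mem_mk_right _ _, hre⟩⟩
  have hrecv : ∀ {o j j' r}, G o j r → G o j' r → j = j' := by
    intro o j j' r hG hG'
    by_contra hne
    have := h2 o j j' hG.2.1 hG'.2.1 hne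
    have hmem : r ∈ I.bundle δ o ∩ I.bundle δ j ∩ I.bundle δ j' := by
      simp only [bundle, Finset.mem_inter, Finset.mem_union]
      exact ⟨⟨.inl hG.1, .inr hG.2.2⟩, .inr hG'.2.2⟩
    rw [this] at hmem
    simp at hmem
  -- Giver and resource are chosen together; `hval` shows that the choice is forced.
  let g : ℕ → ℕ := fun x => if hx : ∃ (j : Fin n) (q : Fin n × Fin m), j = x ∧ G q.1 j q.2
    then hx.choose_spec.choose.1 + 1 else 0
  let P : ℕ → ℕ := fun x => if hx : ∃ (j : Fin n) (q : Fin n × Fin m), j = x ∧ G q.1 j q.2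
    then hx.choose_spec.choose.2 + 1 else 0
  have hval : ∀ {o j r}, G o j r → g j = o + 1 ∧ P j = r + 1 := by
    intro o j r hG
    have hx : ∃ (j' : Fin n) (q : Fin n × Fin m), (j' : ℕ) = (j : ℕ) ∧ G q.1 j' q.2 :=
      ⟨j, (o, r), rfl, hG⟩
    obtain ⟨hj, hG'⟩ := hx.choose_spec.choose_spec
    simp only [g, P, dif_pos hx]
    generalize hx.choose_spec.choose = q at *
    generalize hx.choose = j' at *
    obtain rfl : j' = j := Fin.ext hj
    have hr : q.2 = r := hone hG'.2.2 hG.2.2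
    have ho : q.1 = o := owner_unique hG'.1 (hr ▸ hG.1)
    rw [hr, ho]
    exact ⟨rfl, rfl⟩
  have hinv : ∀ j : Fin n, (g j = 0 ∧ P j = 0) ∨ ∃ o r, G o j r := by
    intro j
    by_cases hx : ∃ (j' : Fin n) (q : Fin n × Fin m), (j' : ℕ) = (j : ℕ) ∧ G q.1 j' q.2
    · obtain ⟨j', q, hj, hG⟩ := hx
      obtain rfl : j' = j := Fin.ext hj
      exact .inr ⟨_, _, hG⟩
    · exact .inl ⟨by simp only [g, dif_neg hx], by simp only [P, dif_neg hx]⟩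
  have hginv : ∀ {j o : Fin n}, g j = o + 1 → ∃ r, G o j r := by
    intro j o h
    rcases hinv j with h0 | ⟨o', r, hG⟩
    · omega
    · obtain rfl : o' = o := Fin.ext (by have := (hval hG).1; omega)
      exact ⟨r, hG⟩
  have hPinv : ∀ {j : Fin n} {r : Fin m}, P j = r + 1 → ∃ o, G o j r := by
    intro j r h
    rcases hinv j with h0 | ⟨o, r', hG⟩
    · omega
    · obtain rfl : r' = r := Fin.ext (by have := (hval hG).2; omega)
      exact ⟨o, hG⟩
  have hbun : ∀ a, I.pickBundle P a = I.bundle δ a := by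
    intro a
    ext r
    simp only [bundle, pickBundle, Finset.mem_union, Finset.mem_filter, Finset.mem_univ, true_and]
    constructor
    · rintro (h | h)
      · exact .inl h
      · obtain ⟨o, hG⟩ := hPinv h
        exact .inr hG.2.2
    · rintro (h | h)
      · exact .inl h
      · obtain ⟨o, ho⟩ := I.alloc_complete r
        by_cases hoa : o = a
        · exact .inl (hoa ▸ ho)
        · exact .inr (hval (show G o a r from ⟨ho, hoa, h⟩)).2
  refine ⟨g, P, ⟨?_, ?_, ?_, ?_⟩, ?_, ?_⟩
  · intro j
    rcases hinv j with h | ⟨o, r, hG⟩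
    · omega
    · have := (hval hG).1
      omega
  · intro j o h
    obtain ⟨r, hG⟩ := hginv h
    exact (hedge hG).1
  · intro j j' hj hjj
    rcases hinv j with h | ⟨o, r, hG⟩
    · omega
    · obtain ⟨r', hG'⟩ := hginv (o := o) (by rw [← hjj]; exact (hval hG).1)
      obtain rfl := hone (hedge hG).2 (hedge hG').2
      exact hrecv hG hG'
  · intro j o h
    obtain ⟨r, hG⟩ := hginv h
    rcases hinv o with h | ⟨o', r', hG'⟩
    · exact h.1
    · obtain rfl := hone (hedge hG).2 hG'.2.2
      exact absurd (owner_unique hG'.1 hG.1) hG'.2.1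
  · intro j
    rcases hinv j with h | ⟨o, r, hG⟩
    · exact .inl h.2
    · exact .inr ⟨r, (hval hG).2, o, (hval hG).1, hG.1⟩
  · have : I.pickEnvious P = I.envious δ := by
      ext i
      rw [envious, pickEnvious, Finset.mem_filter, Finset.mem_filter]
      simp only [Envies, PickEnvies, hbun]
    rwa [this]

/-! ## Best picks -/

/-- Every agent picks, among the offered resources that are not dead, one that it values most. -/
def IsBest (I : Instance n m) (g dead P : ℕ → ℕ) : Prop :=
  ∀ j : Fin n, (P j ≠ 0 → dead (P j) = 0) ∧ ∀ r : Fin m, I.Offers g j r → dead (r + 1) = 0 →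
    ∃ r' : Fin m, P j = r' + 1 ∧ I.util j r ≤ I.util j r'

theorem value_pickBundle_zero {P : ℕ → ℕ} (i j : Fin n) (h : P j = 0) :
    I.value i (I.pickBundle P j) = I.value i (I.alloc j) := by
  congr 1
  ext r
  simp [pickBundle, h]

theorem value_pickBundle_succ {P : ℕ → ℕ} (i j : Fin n) {r : Fin m} (h : P j = r + 1)
    (hr : r ∉ I.alloc j) :
    I.value i (I.pickBundle P j) = I.util i r + I.value i (I.alloc j) := by
  have : I.pickBundle P j = insert r (I.alloc j) := by
    ext r'
    simp only [pickBundle, Finset.mem_filter, Finset.mem_univ, true_and, h, Finset.mem_insert,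
      Nat.add_right_cancel_iff, Fin.val_inj]
    tauto
  rw [this, value, Finset.sum_insert hr, value]

/-- The pick of `i` in `Q` is among the candidates over which `P` maximizes, and a pick adds to the
initial bundle because it comes from another owner. -/
theorem value_le_of_isBest {g dead P Q : ℕ → ℕ} (hg : I.IsPairing g) (hP : I.IsLegal g P)
    (hb : I.IsBest g dead P) (hQ : I.IsLegal g Q)
    (hd : ∀ j : Fin n, Q j ≠ 0 → dead (Q j) = 0) (i : Fin n) :
    I.value i (I.pickBundle Q i) ≤ I.value i (I.pickBundle P i) := by
  rcases hQ i with h | ⟨r, hr, hor⟩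
  · rw [value_pickBundle_zero i i h]
    exact Finset.sum_le_sum_of_subset fun r hr => by simp [pickBundle, hr]
  · obtain ⟨r', hr', hle⟩ := (hb i).2 r hor (by rw [← hr]; exact hd i (by omega))
    have hor' : I.Offers g i r' := by
      rcases hP i with h0 | ⟨r'', h'', ho⟩
      · omega
      · obtain rfl : r'' = r' := Fin.ext (by omega)
        exact ho
    rw [value_pickBundle_succ i i hr (hg.not_mem_of_offers hor),
      value_pickBundle_succ i i hr' (hg.not_mem_of_offers hor')]
    omega

/-- If a legal choice `Q` among the resources that are not dead causes no envy of `i`, and the best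
picks `P` make `i` envy `j`, then nobody takes the pick of `j` in `Q`. -/
theorem ne_of_pickEnvies {g dead P Q : ℕ → ℕ} (hg : I.IsPairing g) (hP : I.IsLegal g P)
    (hb : I.IsBest g dead P) (hQ : I.IsLegal g Q)
    (hd : ∀ j : Fin n, Q j ≠ 0 → dead (Q j) = 0) {i j : Fin n} (hi : i ∉ I.pickEnvious Q)
    (h : I.PickEnvies P i j) : P j ≠ 0 ∧ ∀ l : Fin n, Q l ≠ P j := by
  have hle := value_le_of_isBest hg hP hb hQ hd i
  -- With equal picks `j` would hold the same bundle under `Q`, and `i`, no better off there, would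
  -- envy it already.
  have key : Q j ≠ P j := by
    intro hj
    apply hi
    simp only [pickEnvious, Finset.mem_filter, Finset.mem_univ, true_and]
    refine ⟨j, lt_of_le_of_lt hle ?_, h.2⟩
    have : I.pickBundle Q j = I.pickBundle P j := by simp [pickBundle, hj]
    rw [this]
    exact h.1
  -- If `j` picks nothing, nothing alive is offered to it, so `Q j` would be zero as well, against
  -- `key`.
  have hP0 : P j ≠ 0 := by
    intro h0
    rcases hQ j with h' | ⟨r, hr, hor⟩
    · exact key (by omega)
    · obtain ⟨r', hr', -⟩ := (hb j).2 r hor (by rw [← hr]; exact hd j (by omega))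
      omega
  -- A resource is offered to one agent only, so whoever takes `P j` is `j`.
  refine ⟨hP0, fun l hl => ?_⟩
  rcases hQ l with h' | ⟨r, hr, hor⟩
  · omega
  · rcases hP j with h' | ⟨r', hr', hor'⟩
    · omega
    · obtain rfl : r = r' := Fin.ext (by omega)
      obtain rfl := hg.offers_unique hor hor'
      exact key hl

end Instance

/-! ## Evaluation rules -/

instance : Add Expr := ⟨Expr.add⟩

instance : Sub Expr := ⟨Expr.sub⟩

theorem Expr.eval_const (s : Store) (c : ℕ) : (Expr.const c).eval s = c := rfl

theorem Expr.eval_reg (s : Store) (x : ℕ) : (Expr.reg x).eval s = s.reg x := rfl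

theorem Expr.eval_read (s : Store) (a : ℕ) (e : Expr) :
    (Expr.read a e).eval s = s.arr a (e.eval s) := rfl

theorem Expr.eval_add (s : Store) (e e' : Expr) : (e + e').eval s = e.eval s + e'.eval s := rfl

theorem Expr.eval_sub (s : Store) (e e' : Expr) : (e - e').eval s = e.eval s - e'.eval s := rfl

/-- The matrix entry in array `a` with row `i` and column `j`, where array `b` holds the positions
at which the rows start. -/
def Expr.entry (a b : ℕ) (i j : Expr) : Expr := .read a (.read b i + j)

theorem Expr.eval_entry (s : Store) (a b : ℕ) (i j : Expr) :
    (Expr.entry a b i j).eval s = s.arr a (s.arr b (i.eval s) + j.eval s) := rfl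

theorem Store.setReg_reg (s : Store) (x v y : ℕ) :
    (s.setReg x v).reg y = if y = x then v else s.reg y := Function.update_apply ..

theorem Store.setReg_arr (s : Store) (x v a : ℕ) : (s.setReg x v).arr a = s.arr a := rfl

theorem Store.setArr_reg (s : Store) (a i v x : ℕ) : (s.setArr a i v).reg x = s.reg x := rfl

theorem Store.setArr_arr (s : Store) (a i v b : ℕ) :
    (s.setArr a i v).arr b = if b = a then Function.update (s.arr a) i v else s.arr b :=
  Function.update_apply ..

theorem LProg.run_skip (s : Store) : skip.run s = s := rfl

theorem LProg.run_set (s : Store) (x : ℕ) (e : Expr) :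
    (set x e).run s = s.setReg x (e.eval s) := rfl

theorem LProg.run_write (s : Store) (a : ℕ) (i e : Expr) :
    (write a i e).run s = s.setArr a (i.eval s) (e.eval s) := rfl

theorem LProg.run_seq (s : Store) (p q : LProg) : (seq p q).run s = q.run (p.run s) := rfl

theorem LProg.run_branch (s : Store) (e : Expr) (p q : LProg) :
    (branch e p q).run s = if e.eval s = 0 then q.run s else p.run s := rfl

open LProg ERSA.Expr

/-! ## Memory layout

Registers: 0 `n`, 1 `m`, 2 `k`, 3 `3 * n`, 4 number of digit vectors, 5 answer, 6 and 7 agents,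
8 resource, 9 and 10 counters, 11 `m + 1`, 12 partner, 13 best value, 14 and 15 envy of one agent
and number of envious agents, 16 and 17 values of bundles, 18 carry, 19 `n + 2`, 20 position of a
digit, 21 and 22 row positions, 23 accumulator.

Arrays: 0 to 3 input, 4 and 5 row positions for matrices with `m` and with `n` columns, 6 radices,
7 digits, 8 givers, 9 matched agents, 10 dead picks, 11 picks. -/

/-- The radix of digit `x` of the enumeration: for each agent a bit that says whether it must not be
envious, a bit that gives the direction of its edge, and the distance of its partner. -/
def radix (n x : ℕ) : ℕ := if x < n + n then 2 else n + n + n - x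

namespace Instance

variable {n m : ℕ} {I : Instance n m}

/-- The parts of the memory that stay fixed while digit vectors are enumerated. -/
structure Ready (I : Instance n m) (s : Store) : Prop where
  regN : s.reg 0 = n
  regM : s.reg 1 = m
  regK : s.reg 2 = I.k
  regL : s.reg 3 = n + n + n
  regR : s.reg 11 = m + 1
  util : ∀ (i : Fin n) (r : Fin m), s.arr 0 (s.arr 4 i + r) = I.util i r
  alloc : ∀ (i : Fin n) (r : Fin m), s.arr 1 (s.arr 4 i + r) ≠ 0 ↔ r ∈ I.alloc i
  share : ∀ i j : Fin n, s.arr 2 (s.arr 5 i + j) ≠ 0 ↔ I.share.Adj i j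
  att : ∀ i j : Fin n, s.arr 3 (s.arr 5 i + j) ≠ 0 ↔ I.att.Adj i j
  rad : ∀ x < n + n + n, s.arr 6 x = radix n x

/-- For concrete programs both side conditions are decidable, so `Ready` passes through every later
stage by `decide`. -/
theorem Ready.frame {p : LProg} {s t : Store} (h : I.Ready s) (hf : p.Frame s t)
    (hr : ∀ x ∈ [0, 1, 2, 3, 11], x ∉ p.modReg)
    (ha : ∀ a ∈ [0, 1, 2, 3, 4, 5, 6], a ∉ p.modArr) : I.Ready t := by
  have hr' : ∀ x ∈ [0, 1, 2, 3, 11], t.reg x = s.reg x := fun x hx => hf.reg x (hr x hx)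
  have ha' : ∀ a ∈ [0, 1, 2, 3, 4, 5, 6], t.arr a = s.arr a := fun a h => hf.arr a (ha a h)
  simp only [List.forall_mem_cons] at hr' ha'
  obtain ⟨h0, h1, h2, h3, h11, -⟩ := hr'
  obtain ⟨a0, a1, a2, a3, a4, a5, a6, -⟩ := ha'
  constructor
  · rw [h0, h.regN]
  · rw [h1, h.regM]
  · rw [h2, h.regK]
  · rw [h3, h.regL]
  · rw [h11, h.regR]
  · rw [a0, a4]; exact h.util
  · rw [a1, a4]; exact h.alloc
  · rw [a2, a5]; exact h.share
  · rw [a3, a5]; exact h.att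
  · rw [a6]; exact h.rad

end Instance

/-! ## Evaluation of picks -/

/-- Put the value of agent (register 6) for the bundle of agent (register `x`) into register `v`. -/
def bundleValue (x v : ℕ) : LProg :=
  .seq (.set v (.const 0)) (.rep 8 1 (.branch
    -- The two truncated differences add up to the distance of the pick from `r + 1`; one minus it
    -- is nonzero exactly when `r` is the pick. The sum thus tests membership in `pickBundle`.
    (entry 1 4 (.reg x) (.reg 8) + (.const 1 - ((.read 11 (.reg x) - (.reg 8 + .const 1)) +
      ((.reg 8 + .const 1) - .read 11 (.reg x)))))
    (.set v (.reg v + entry 0 4 (.reg 6) (.reg 8))) .skip))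

/-- Let agent (register 7) pick resource (register 8) if possible and not worse. -/
def chooseStep : LProg :=
  .branch (.read 8 (.reg 7)) (.branch (entry 1 4 (.read 8 (.reg 7) - .const 1) (.reg 8))
    (.branch (.read 10 (.reg 8 + .const 1)) .skip
      -- Ties replace the pick, so that a resource of utility zero is still preferred to picking
      -- nothing, as `IsBest` demands.
      (.branch (.reg 13 - entry 0 4 (.reg 7) (.reg 8)) .skip
        (.seq (.set 13 (entry 0 4 (.reg 7) (.reg 8))) (.write 11 (.reg 7) (.reg 8 + .const 1)))))
    .skip) .skip

/-- Compute best picks. -/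
def choose : LProg :=
  .rep 7 0 (.seq (.set 13 (.const 0)) (.seq (.write 11 (.reg 7) (.const 0)) (.rep 8 1 chooseStep)))

/-- Note whether agent (register 6) envies agent (register 7), and kill the pick of the latter if
the former must not be envious. -/
def judgeStep : LProg :=
  .branch (entry 3 5 (.reg 6) (.reg 7))
    (.seq (bundleValue 6 16) (.seq (bundleValue 7 17) (.branch (.reg 17 - .reg 16)
      (.seq (.set 14 (.const 1))
        -- If `j` has no pick, this marks cell 0, which stands for no resource.
        (.branch (.read 7 (.reg 6)) (.write 10 (.read 11 (.reg 7)) (.const 1)) .skip)) .skip)))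
    .skip

/-- Count the envious agents and kill picks. -/
def judge : LProg :=
  .seq (.set 15 (.const 0)) (.rep 6 0 (.seq (.set 14 (.const 0))
    (.seq (.rep 7 0 judgeStep) (.set 15 (.reg 15 + .reg 14)))))

/-- Set the answer if the best picks make few agents envious; kill picks otherwise. -/
def round : LProg :=
  .seq choose (.seq judge (.branch ((.const 1 + .reg 2) - .reg 15) (.set 5 (.const 1)) .skip))

namespace Instance

variable {n m : ℕ} {I : Instance n m} {s : Store}

theorem Ready.bundleValue_run (h : I.Ready s) {i j : Fin n} {x v : ℕ} (hi : s.reg 6 = i)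
    (hj : s.reg x = j) (hxv : x ≠ v) (hx : x ≠ 8) (h8 : 8 ≠ v) (h6 : 6 ≠ v) (h1 : 1 ≠ v) :
    ((bundleValue x v).run s).reg v = I.value i (I.pickBundle (s.arr 11) j) := by
  let F : ℕ → ℕ := fun r => if s.arr 1 (s.arr 4 j + r) = 0 ∧ s.arr 11 j ≠ r + 1 then 0
    else s.arr 0 (s.arr 4 i + r)
  have hF : I.value i (I.pickBundle (s.arr 11) j) = ∑ r ∈ Finset.range m, F r := by
    rw [Finset.sum_range, value, pickBundle, Finset.sum_filter]
    refine Finset.sum_congr rfl fun r _ => ?_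
    have := h.alloc j r
    simp only [F, h.util, ← this]
    by_cases h1 : s.arr 1 (s.arr 4 j + r) = 0 <;> by_cases h2 : s.arr 11 j = r + 1 <;>
      simp [h1, h2]
  have key := run_rep 8 1 (.branch
    (entry 1 4 (.reg x) (.reg 8) + (.const 1 - ((.read 11 (.reg x) - (.reg 8 + .const 1)) +
      ((.reg 8 + .const 1) - .read 11 (.reg x)))))
    (.set v (.reg v + entry 0 4 (.reg 6) (.reg 8))) .skip) (s.setReg v 0)
    (fun b t => t.reg v = ∑ r ∈ Finset.range b, F r)
    (by simp [Store.setReg_reg, h8.symm]) (by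
      intro b t hb hf hr hP
      have e6 := hf.reg 6 (by simp [modReg, h6])
      have ex := hf.reg x (by simp [modReg, hx, hxv])
      have ea := fun a => hf.arr a (by simp [modArr])
      simp only [Store.setReg_reg, Store.setReg_arr, if_neg h6, if_neg hxv, hi, hj] at e6 ex ea
      simp only [run_branch, run_set, run_skip, eval_add, eval_sub, eval_entry, eval_read,
        eval_reg, eval_const, e6, ex, ea, hr, Finset.sum_range_succ, ← hP, F]
      split_ifs with c1 c2 c2
      · simp [Store.setReg_reg, h8.symm]
      · omega
      · omega
      · simp [Store.setReg_reg, h8.symm])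
  rw [hF, bundleValue, run_seq, run_set, eval_const]
  simpa [Store.setReg_reg, h1, h.regM] using key

/-- The pick `p` of agent `j` is best among the resources below `b`. -/
def GoodPick (I : Instance n m) (g dead : ℕ → ℕ) (j : Fin n) (b p : ℕ) : Prop :=
  (p = 0 ∨ ∃ r : Fin m, p = r + 1 ∧ I.Offers g j r ∧ dead (r + 1) = 0) ∧
    ∀ r : Fin m, r < b → I.Offers g j r → dead (r + 1) = 0 →
      ∃ r' : Fin m, p = r' + 1 ∧ I.util j r ≤ I.util j r'

/-- The running maximum: register 13 holds the utility of the current pick, or zero when there is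
none. -/
theorem Ready.chooseStep_run (h : I.Ready s) (hg : ∀ j : Fin n, s.arr 8 j ≤ n) {j : Fin n}
    {r : Fin m} (hj : s.reg 7 = j) (hr : s.reg 8 = r)
    (hp : I.GoodPick (s.arr 8) (s.arr 10) j r (s.arr 11 j))
    (h0 : s.arr 11 j = 0 → s.reg 13 = 0)
    (h1 : ∀ r' : Fin m, s.arr 11 j = r' + 1 → s.reg 13 = I.util j r') :
    let t := chooseStep.run s
    I.GoodPick (s.arr 8) (s.arr 10) j (r + 1) (t.arr 11 j) ∧
      (t.arr 11 j = 0 → t.reg 13 = 0) ∧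
      (∀ r' : Fin m, t.arr 11 j = r' + 1 → t.reg 13 = I.util j r') ∧
      ∀ x : ℕ, x ≠ j → t.arr 11 x = s.arr 11 x := by
  have hoff : I.Offers (s.arr 8) j r ↔
      s.arr 8 j ≠ 0 ∧ s.arr 1 (s.arr 4 (s.arr 8 j - 1) + r) ≠ 0 := by
    constructor
    · rintro ⟨o, ho, hor⟩
      refine ⟨by omega, ?_⟩
      rw [ho, Nat.add_sub_cancel]
      exact (h.alloc o r).mpr hor
    · rintro ⟨hne, ha⟩
      have := hg j
      refine ⟨⟨s.arr 8 j - 1, by omega⟩, by simp only []; omega, ?_⟩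
      exact (h.alloc ⟨s.arr 8 j - 1, by omega⟩ r).mp ha
  -- All three ways of keeping the old pick reduce to this case.
  have hskip : ¬ (I.Offers (s.arr 8) j r ∧ s.arr 10 (r + 1) = 0 ∧ s.reg 13 ≤ I.util j r) →
      I.GoodPick (s.arr 8) (s.arr 10) j (r + 1) (s.arr 11 j) := by
    intro hn
    refine ⟨hp.1, fun r' hr' ho hd => ?_⟩
    by_cases hlt : r' < r
    · exact hp.2 r' hlt ho hd
    · obtain rfl : r' = r := by omega
      rcases hp.1 with hz | ⟨r'', h'', -⟩
      · exact absurd ⟨ho, hd, by rw [h0 hz]; exact Nat.zero_le _⟩ hn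
      · refine ⟨r'', h'', ?_⟩
        have := h1 r'' h''
        by_contra hlt
        exact hn ⟨ho, hd, by omega⟩
  simp only [chooseStep, run_branch, run_seq, run_set, run_write, run_skip, eval_add, eval_sub,
    eval_entry, eval_read, eval_reg, eval_const, hj, hr, h.util]
  split_ifs with c1 c2 c3 c4
  · exact ⟨hskip fun hc => (hoff.mp hc.1).1 c1, h0, h1, fun _ _ => rfl⟩
  · exact ⟨hskip fun hc => (hoff.mp hc.1).2 c2, h0, h1, fun _ _ => rfl⟩
  · have hdo : ∀ r' : Fin m, r' < (r : ℕ) + 1 → s.reg 13 ≤ I.util j r →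
        I.Offers (s.arr 8) j r' → s.arr 10 (r' + 1) = 0 → I.util j r' ≤ I.util j r := by
      intro r' hr' hle ho hd
      by_cases hlt : r' < r
      · obtain ⟨r'', h'', hle'⟩ := hp.2 r' hlt ho hd
        have := h1 r'' h''
        omega
      · obtain rfl : r' = r := by omega
        exact le_rfl
    simp only [Store.setReg_reg, Store.setReg_arr, Store.setArr_reg, Store.setArr_arr, if_true,
      hj, hr]
    refine ⟨⟨.inr ⟨r, by simp, hoff.mpr ⟨c1, c2⟩, c3⟩, fun r' hr' ho hd => ⟨r, by simp, ?_⟩⟩,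
      by simp, fun r' hr' => ?_, fun x hx => by simp [Function.update_of_ne hx]⟩
    · exact hdo r' hr' (by omega) ho hd
    · obtain rfl : r = r' := by simpa [Fin.ext_iff] using hr'
      simp
  · refine ⟨hskip fun hc => ?_, h0, h1, fun _ _ => rfl⟩
    omega
  · exact ⟨hskip fun hc => c3 hc.2.1, h0, h1, fun _ _ => rfl⟩

theorem Ready.choose_run (h : I.Ready s) (hg : ∀ j : Fin n, s.arr 8 j ≤ n) :
    I.IsLegal (s.arr 8) ((choose.run s).arr 11) ∧
      I.IsBest (s.arr 8) (s.arr 10) ((choose.run s).arr 11) := by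
  have key := run_rep 7 0 (.seq (.set 13 (.const 0)) (.seq (.write 11 (.reg 7) (.const 0))
    (.rep 8 1 chooseStep))) s
    (fun b t => ∀ j : Fin n, j < b → I.GoodPick (s.arr 8) (s.arr 10) j m (t.arr 11 j))
    (by simp) (by
      intro b t hb hf hr hP j hj
      rw [h.regN] at hb
      have ht : I.Ready t := h.frame hf (by decide) (by decide)
      have e8 := hf.arr 8 (by decide)
      have e10 := hf.arr 10 (by decide)
      clear hf
      simp only [run_seq, run_set, run_write, eval_const, eval_reg, Store.setReg_reg, hr,
        Nat.reduceEqDiff, reduceIte]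
      set t' := (t.setReg 13 0).setArr 11 b 0 with ht'
      have hreg : ∀ x, x ≠ 13 → t'.reg x = t.reg x := by
        intro x hx
        simp [ht', Store.setReg_reg, Store.setArr_reg, hx]
      have harr : ∀ a, a ≠ 11 → t'.arr a = t.arr a := by
        intro a ha
        simp [ht', Store.setReg_arr, Store.setArr_arr, ha]
      have hrt' : I.Ready t' := by
        refine ht.frame (p := .seq (.set 13 (.const 0)) (.write 11 (.const b) (.const 0)))
          (t := t') (frame_run _ t) (by simp [modReg]) (by simp [modArr])
      have hin := run_rep 8 1 chooseStep t'
        (fun c u => I.GoodPick (s.arr 8) (s.arr 10) ⟨b, hb⟩ c (u.arr 11 b) ∧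
          (u.arr 11 b = 0 → u.reg 13 = 0) ∧
          (∀ r' : Fin m, u.arr 11 b = r' + 1 → u.reg 13 = I.util ⟨b, hb⟩ r') ∧
          ∀ x, x ≠ b → u.arr 11 x = t.arr 11 x)
        (by
          simp only [Store.setReg_arr, Store.setReg_reg, ht', Store.setArr_arr, Store.setArr_reg]
          refine ⟨⟨.inl (by simp), by simp⟩, by simp, by simp, fun x hx => ?_⟩
          simp [Function.update_of_ne hx])
        (by
          intro c u hc hf hr8 hu
          rw [hrt'.regM] at hc
          have hru : I.Ready u := hrt'.frame hf (by decide) (by decide)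
          have f8 := hf.arr 8 (by decide)
          have f10 := hf.arr 10 (by decide)
          have f7 := hf.reg 7 (by decide)
          rw [harr _ (by decide), e8] at f8
          rw [harr _ (by decide), e10] at f10
          rw [hreg _ (by decide), hr] at f7
          have := hru.chooseStep_run (j := ⟨b, hb⟩) (r := ⟨c, hc⟩) (by rw [f8]; exact hg) f7 hr8
            (by rw [f8, f10]; exact hu.1) hu.2.1 hu.2.2.1
          simp only [f8, f10] at this
          obtain ⟨q1, q2, q3, q4⟩ := this
          simp only [Store.setReg_arr, Store.setReg_reg]
          exact ⟨q1, q2, q3, fun x hx => (q4 x hx).trans (hu.2.2.2 x hx)⟩)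
      simp only [hrt'.regM] at hin
      simp only [Store.setReg_arr]
      by_cases hjb : (j : ℕ) = b
      · obtain rfl : j = ⟨b, hb⟩ := Fin.ext hjb
        exact hin.1
      · rw [hin.2.2.2 j hjb]
        exact hP j (by omega))
  rw [h.regN] at key
  change ∀ j : Fin n, j < n → I.GoodPick (s.arr 8) (s.arr 10) j m ((choose.run s).arr 11 j) at key
  refine ⟨fun j => ?_, fun j => ⟨fun hne => ?_, fun r ho hd => ?_⟩⟩
  · rcases (key j j.2).1 with h | ⟨r, h1, h2, -⟩
    exacts [.inl h, .inr ⟨r, h1, h2⟩]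
  · rcases (key j j.2).1 with h | ⟨r, h1, -, h3⟩
    exacts [absurd h hne, by rw [h1]; exact h3]
  · exact (key j j.2).2 r r.2 ho hd

end Instance

/-- Repeat until the picks are stable. -/
def rounds : LProg := .rep 10 11 round

namespace Instance

variable {n m : ℕ} {I : Instance n m} {s : Store}

open Classical in
theorem Ready.judgeStep_run (h : I.Ready s) {i j : Fin n} (hi : s.reg 6 = i) (hj : s.reg 7 = j) :
    let t := judgeStep.run s
    t.reg 14 = (if I.PickEnvies (s.arr 11) i j then 1 else s.reg 14) ∧
      t.arr 10 = (if I.PickEnvies (s.arr 11) i j ∧ s.arr 7 i ≠ 0 then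
        Function.update (s.arr 10) (s.arr 11 j) 1 else s.arr 10) := by
  have f1 := frame_run (bundleValue 6 16) s
  have v1 := h.bundleValue_run (v := 16) hi hi (by decide) (by decide) (by decide) (by decide)
    (by decide)
  set t1 := (bundleValue 6 16).run s
  have r1 : I.Ready t1 := h.frame f1 (by decide) (by decide)
  have f2 := frame_run (bundleValue 7 17) t1
  have v2 := r1.bundleValue_run (v := 17) ((f1.reg 6 (by decide)).trans hi)
    ((f1.reg 7 (by decide)).trans hj) (by decide) (by decide) (by decide) (by decide) (by decide)
  set t2 := (bundleValue 7 17).run t1 with ht2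
  rw [f1.arr 11 (by decide)] at v2
  have v1' := (f2.reg 16 (by decide)).trans v1
  have ha : ∀ a, t2.arr a = s.arr a := fun a =>
    (f2.arr a (by simp [bundleValue, modArr])).trans (f1.arr a (by simp [bundleValue, modArr]))
  have e6 := ((f2.reg 6 (by decide)).trans (f1.reg 6 (by decide))).trans hi
  have e7 := ((f2.reg 7 (by decide)).trans (f1.reg 7 (by decide))).trans hj
  have e14 := (f2.reg 14 (by decide)).trans (f1.reg 14 (by decide))
  have hatt := h.att i j
  simp only [judgeStep, run_branch, run_seq, run_set, run_write, run_skip, eval_sub, eval_entry,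
    eval_read, eval_reg, eval_const, hi, hj]
  change _ ∧ _
  rw [← ht2]
  simp only [v1', v2, Store.setReg_reg, Store.setReg_arr, ha, e6, PickEnvies, Nat.reduceEqDiff,
    reduceIte]
  by_cases c1 : I.att.Adj i j
  · have c1' := hatt.mpr c1
    by_cases c2 : I.value i (I.pickBundle (s.arr 11) i) < I.value i (I.pickBundle (s.arr 11) j)
    · have c2' := Nat.sub_ne_zero_of_lt c2
      by_cases c3 : s.arr 7 i = 0 <;>
        simp [c1, c1', c2, c2', c3, ha, e7, Store.setReg_reg, Store.setArr_reg, Store.setReg_arr,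
          Store.setArr_arr]
    · have c2' := Nat.sub_eq_zero_of_le (not_lt.mp c2)
      simp [c1, c1', c2, c2', ha, e14]
  · have c1' : s.arr 3 (s.arr 5 i + j) = 0 := by
      by_contra hne
      exact c1 (hatt.mp hne)
    simp [c1, c1']

open Classical in
theorem Ready.judge_run (h : I.Ready s) :
    let t := judge.run s
    t.reg 15 = (I.pickEnvious (s.arr 11)).card ∧
      ∀ p, t.arr 10 p ≠ 0 ↔ s.arr 10 p ≠ 0 ∨ ∃ i j : Fin n, s.arr 7 i ≠ 0 ∧
        I.PickEnvies (s.arr 11) i j ∧ s.arr 11 j = p := by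
  have key := run_rep 6 0 (.seq (.set 14 (.const 0)) (.seq (.rep 7 0 judgeStep)
    (.set 15 (.reg 15 + .reg 14)))) (s.setReg 15 0)
    (fun b t => t.reg 15 = (Finset.univ.filter fun i : Fin n =>
        i < b ∧ ∃ j, I.PickEnvies (s.arr 11) i j).card ∧
      ∀ p, t.arr 10 p ≠ 0 ↔ s.arr 10 p ≠ 0 ∨ ∃ i j : Fin n, i < b ∧ s.arr 7 i ≠ 0 ∧
        I.PickEnvies (s.arr 11) i j ∧ s.arr 11 j = p)
    (by simp [Store.setReg_reg, Store.setReg_arr]) (by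
      intro b t hb hf hr hP
      simp only [Store.setReg_reg, reduceIte, h.regN, OfNat.zero_ne_ofNat] at hb
      have hs' : I.Ready (s.setReg 15 0) :=
        h.frame (frame_run (.set 15 (.const 0)) s) (by decide) (by decide)
      have ht : I.Ready t := hs'.frame hf (by decide) (by decide)
      have e7 : t.arr 7 = s.arr 7 := hf.arr 7 (by decide)
      have e11 : t.arr 11 = s.arr 11 := hf.arr 11 (by decide)
      clear hf
      simp only [run_seq, run_set, eval_const, eval_reg, eval_add, Store.setReg_reg,
        Store.setReg_arr, Nat.reduceEqDiff, reduceIte]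
      have ht' : I.Ready (t.setReg 14 0) :=
        ht.frame (frame_run (.set 14 (.const 0)) t) (by decide) (by decide)
      have hin := run_rep 7 0 judgeStep (t.setReg 14 0)
        (fun c u => u.reg 14 = (if ∃ j : Fin n, j < c ∧ I.PickEnvies (s.arr 11) ⟨b, hb⟩ j
            then 1 else 0) ∧
          ∀ p, u.arr 10 p ≠ 0 ↔ t.arr 10 p ≠ 0 ∨ ∃ j : Fin n, j < c ∧ s.arr 7 b ≠ 0 ∧
            I.PickEnvies (s.arr 11) ⟨b, hb⟩ j ∧ s.arr 11 j = p)
        (by simp [Store.setReg_reg, Store.setReg_arr])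
        (by
          intro c u hc hf hr7 hu
          rw [ht'.regN] at hc
          have hru : I.Ready u := ht'.frame hf (by decide) (by decide)
          have f7 : u.arr 7 = s.arr 7 := (hf.arr 7 (by decide)).trans e7
          have f11 : u.arr 11 = s.arr 11 := (hf.arr 11 (by decide)).trans e11
          have f6 : u.reg 6 = b := (hf.reg 6 (by decide)).trans hr
          have := hru.judgeStep_run (i := ⟨b, hb⟩) (j := ⟨c, hc⟩) f6 hr7
          simp only [f7, f11] at this
          obtain ⟨q1, q2⟩ := this
          have hsplit : ∀ (p : Fin n → Prop), (∃ j : Fin n, (j : ℕ) < c + 1 ∧ p j) ↔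
              (∃ j : Fin n, (j : ℕ) < c ∧ p j) ∨ p ⟨c, hc⟩ := by
            intro p
            constructor
            · rintro ⟨j, hj, hp⟩
              by_cases hjc : (j : ℕ) = c
              · obtain rfl : j = ⟨c, hc⟩ := Fin.ext hjc
                exact .inr hp
              · exact .inl ⟨j, by omega, hp⟩
            · rintro (⟨j, hj, hp⟩ | hp)
              exacts [⟨j, by omega, hp⟩, ⟨⟨c, hc⟩, by simp, hp⟩]
          simp only [Store.setReg_reg, Store.setReg_arr, Nat.reduceEqDiff, reduceIte]
          refine ⟨?_, fun p => ?_⟩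
          · rw [q1, hu.1]
            simp only [hsplit]
            by_cases a1 : I.PickEnvies (s.arr 11) ⟨b, hb⟩ ⟨c, hc⟩ <;> simp [a1]
          · rw [q2, hsplit, ← or_assoc, ← hu.2 p]
            by_cases a1 : I.PickEnvies (s.arr 11) ⟨b, hb⟩ ⟨c, hc⟩ <;>
              by_cases a2 : s.arr 7 b = 0 <;> simp [a1, a2]
            by_cases a3 : p = s.arr 11 c
            · simp [a3]
            · rw [Function.update_of_ne a3]
              simp [Ne.symm a3])
      simp only [ht'.regN] at hin
      obtain ⟨q1, q2⟩ := hin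
      have e15 := (frame_run (.rep 7 0 judgeStep) (t.setReg 14 0)).reg 15 (by decide)
      simp only [Store.setReg_reg, Nat.reduceEqDiff, reduceIte] at e15
      refine ⟨?_, fun p => ?_⟩
      · rw [e15, q1, hP.1]
        have hset : (Finset.univ.filter fun i : Fin n =>
            i < b + 1 ∧ ∃ j, I.PickEnvies (s.arr 11) i j) =
            (Finset.univ.filter fun i : Fin n => i < b ∧ ∃ j, I.PickEnvies (s.arr 11) i j) ∪
            (if ∃ j, I.PickEnvies (s.arr 11) ⟨b, hb⟩ j then {⟨b, hb⟩} else ∅) := by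
          ext i
          simp only [Finset.mem_union, Finset.mem_filter, Finset.mem_univ, true_and]
          by_cases hib : (i : ℕ) = b
          · obtain rfl : i = ⟨b, hb⟩ := Fin.ext hib
            split_ifs with hc <;> simp [hc]
          · have : i ∉ (if ∃ j, I.PickEnvies (s.arr 11) ⟨b, hb⟩ j then
                ({⟨b, hb⟩} : Finset (Fin n)) else ∅) := by
              split_ifs <;> simp [Fin.ext_iff, hib]
            simp only [this, or_false]
            exact and_congr_left fun _ => by omega
        rw [hset, Finset.card_union_of_disjoint]
        · simp only [Fin.is_lt, true_and]
          split_ifs <;> simp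
        · split_ifs <;> simp
      · rw [q2, hP.2, or_assoc]
        refine or_congr_right ⟨?_, ?_⟩
        · rintro (⟨i, j, hi, hx⟩ | ⟨j, hj, hx⟩)
          exacts [⟨i, j, by omega, hx⟩, ⟨⟨b, hb⟩, j, by simp, hx⟩]
        · rintro ⟨i, j, hi, hx⟩
          by_cases hib : (i : ℕ) = b
          · obtain rfl : i = ⟨b, hb⟩ := Fin.ext hib
            exact .inr ⟨j, j.2, hx⟩
          · exact .inl ⟨i, j, by omega, hx⟩)
  simp only [Store.setReg_reg, OfNat.zero_ne_ofNat, reduceIte, h.regN, Fin.is_lt, true_and] at key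
  exact key

/-- This is the interface between memory and combinatorics: later arguments know the picks only
through legality and optimality. -/
theorem Ready.round_run (h : I.Ready s) (hg : ∀ j : Fin n, s.arr 8 j ≤ n) :
    let t := round.run s
    ∃ P : ℕ → ℕ, I.IsLegal (s.arr 8) P ∧ I.IsBest (s.arr 8) (s.arr 10) P ∧
      t.reg 5 = (if (I.pickEnvious P).card ≤ I.k then 1 else s.reg 5) ∧
      ∀ p, t.arr 10 p ≠ 0 ↔ s.arr 10 p ≠ 0 ∨ ∃ i j : Fin n, s.arr 7 i ≠ 0 ∧
        I.PickEnvies P i j ∧ P j = p := by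
  obtain ⟨hl, hb⟩ := h.choose_run hg
  have f1 := frame_run choose s
  set s1 := choose.run s with hs1
  have r1 : I.Ready s1 := h.frame f1 (by decide) (by decide)
  obtain ⟨h15, h10⟩ := r1.judge_run
  have f2 := frame_run judge s1
  set s2 := judge.run s1 with hs2
  have r2 : I.Ready s2 := r1.frame f2 (by decide) (by decide)
  have e5 := (f2.reg 5 (by decide)).trans (f1.reg 5 (by decide))
  rw [f1.arr 10 (by decide), f1.arr 7 (by decide)] at h10
  refine ⟨s1.arr 11, hl, hb, ?_⟩
  simp only [round, run_seq, run_branch, run_set, run_skip, eval_sub, eval_add, eval_reg,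
    eval_const, ← hs1, ← hs2, h15, r2.regK]
  by_cases hk : (I.pickEnvious (s1.arr 11)).card ≤ I.k
  · rw [if_neg (by omega), if_pos hk]
    exact ⟨by simp [Store.setReg_reg], h10⟩
  · rw [if_pos (by omega), if_neg hk]
    exact ⟨e5, h10⟩

/-! ### Soundness and completeness of the elimination of resources -/

/-- The resources that are dead according to `a`. -/
def deadSet (m : ℕ) (a : ℕ → ℕ) : Finset (Fin m) :=
  Finset.univ.filter fun r => a (r + 1) ≠ 0

theorem mem_deadSet {a : ℕ → ℕ} {r : Fin m} : r ∈ deadSet m a ↔ a (r + 1) ≠ 0 := by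
  simp [deadSet]

/-- No assumption on the protected or dead sets is needed, because legal picks with few envious
agents are a solution however they were found. -/
theorem Ready.rounds_sound (h : I.Ready s) (hg : I.IsPairing (s.arr 8)) :
    (rounds.run s).reg 5 = s.reg 5 ∨ ((rounds.run s).reg 5 = 1 ∧ I.IsYes) := by
  refine run_rep 10 11 round s (fun _ t => t.reg 5 = s.reg 5 ∨ (t.reg 5 = 1 ∧ I.IsYes))
    (.inl (by simp [Store.setReg_reg])) ?_
  intro b t hb hf hr hP
  have ht : I.Ready t := h.frame hf (by decide) (by decide)
  have e8 := hf.arr 8 (by decide)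
  obtain ⟨P, hl, -, h5, -⟩ := ht.round_run (by rw [e8]; exact hg.le)
  simp only [Store.setReg_reg, Nat.reduceEqDiff, reduceIte]
  rw [h5]
  split_ifs with hk
  · exact .inr ⟨rfl, isYes_of_pick (by rw [e8]; exact hg) hl hk⟩
  · exact hP

/-- The number of dead resources is the potential: until the answer is set, it grows in every round
while the picks of `Q` stay alive. -/
theorem Ready.rounds_complete (h : I.Ready s) (hg : I.IsPairing (s.arr 8)) {Q : ℕ → ℕ}
    (hQ : I.IsLegal (s.arr 8) Q) (hk : (I.pickEnvious Q).card ≤ I.k)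
    (hC : ∀ i : Fin n, s.arr 7 i ≠ 0 ↔ i ∉ I.pickEnvious Q)
    (hd : ∀ r : Fin m, s.arr 10 (r + 1) = 0) : (rounds.run s).reg 5 = 1 := by
  have key := run_rep 10 11 round s (fun b t => t.reg 5 = 1 ∨
    (b ≤ (deadSet m (t.arr 10)).card ∧
      ∀ j : Fin n, Q j ≠ 0 → t.arr 10 (Q j) = 0))
    (.inr ⟨by simp, fun j hj => by
      rcases hQ j with h0 | ⟨r, hr, -⟩
      · exact absurd h0 hj
      · rw [hr]; exact hd r⟩) (by
    intro b t hb hf hr hP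
    have ht : I.Ready t := h.frame hf (by decide) (by decide)
    have e8 := hf.arr 8 (by decide)
    have e7 := hf.arr 7 (by decide)
    obtain ⟨P, hl, hbest, h5, h10⟩ := ht.round_run (by rw [e8]; exact hg.le)
    simp only [Store.setReg_reg, Store.setReg_arr, Nat.reduceEqDiff, reduceIte]
    rw [h5]
    split_ifs with hk'
    · exact .inl rfl
    · refine hP.imp id ?_
      rintro ⟨hcard, halive⟩
      rw [e8] at hl hbest
      rw [e7] at h10
      -- More than `k` agents are envious under `P` and at most `k` under `Q`, so some protected
      -- agent is envious.
      obtain ⟨i, hi, hiQ⟩ : ∃ i, i ∈ I.pickEnvious P ∧ i ∉ I.pickEnvious Q := by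
        by_contra! hcon
        exact hk' ((Finset.card_le_card hcon).trans hk)
      obtain ⟨j, hj⟩ := mem_pickEnvious.mp hi
      obtain ⟨hne, -⟩ := ne_of_pickEnvies hg hl hbest hQ halive hiQ hj
      obtain ⟨r, hr, -⟩ := (hl j).resolve_left hne
      refine ⟨?_, fun l hl0 => ?_⟩
      · refine Nat.succ_le_of_lt (lt_of_le_of_lt hcard (Finset.card_lt_card ?_))
        rw [Finset.ssubset_iff_of_subset]
        · refine ⟨r, ?_, ?_⟩
          · rw [mem_deadSet, h10]
            exact .inr ⟨i, j, (hC i).mpr hiQ, hj, hr⟩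
          -- The killed pick was alive before the round, so the dead set grows strictly.
          · have := (hbest j).1 hne
            rw [hr] at this
            simp [mem_deadSet, this]
        · intro r' hr'
          rw [mem_deadSet] at hr' ⊢
          exact (h10 _).mpr (.inl hr')
      · by_contra hdead
        rcases (h10 _).mp hdead with hx | ⟨i', j', hi', hj', he⟩
        · exact hx (halive l hl0)
        · exact (ne_of_pickEnvies hg hl hbest hQ halive ((hC i').mp hi') hj').2 l he.symm)
  rw [h.regR] at key
  rcases key with h | ⟨h, -⟩
  · exact h
  -- After `m + 1` rounds without success, `m + 1` of the `m` resources would be dead.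
  · have := Finset.card_le_univ (deadSet m (((rep 10 11 round).run s).arr 10))
    rw [Fintype.card_fin] at this
    omega

end Instance

/-! ## Decoding of digits -/

/-- Match agent (register 6) with its partner if they are neighbours and both still free. -/
def decodeStep : LProg :=
  .seq (.set 12 (.reg 6 + .read 7 (.reg 0 + .reg 0 + .reg 6)))
    (.branch (entry 2 5 (.reg 6) (.reg 12)) (.branch (.read 9 (.reg 6) + .read 9 (.reg 12)) .skip
      (.seq (.write 9 (.reg 6) (.const 1)) (.seq (.write 9 (.reg 12) (.const 1))
        (.branch (.read 7 (.reg 0 + .reg 6)) (.write 8 (.reg 12) (.reg 6 + .const 1))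
          (.write 8 (.reg 6) (.reg 12 + .const 1)))))) .skip)

/-- Compute the pairing that belongs to the digits. -/
def decode : LProg :=
  .seq (.rep 6 0 (.seq (.write 8 (.reg 6) (.const 0)) (.write 9 (.reg 6) (.const 0))))
    (.rep 6 0 decodeStep)

namespace Instance

variable {n m : ℕ} {I : Instance n m} {s : Store}

theorem Ready.decodeStep_run (h : I.Ready s) {i p : Fin n} (hi : s.reg 6 = i)
    (hp : i + s.arr 7 (n + n + i) = p) :
    let t := decodeStep.run s
    (I.share.Adj i p ∧ s.arr 9 i = 0 ∧ s.arr 9 p = 0 →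
      t.arr 9 = Function.update (Function.update (s.arr 9) i 1) p 1 ∧
      t.arr 8 = (if s.arr 7 (n + i) = 0 then Function.update (s.arr 8) i (p + 1)
        else Function.update (s.arr 8) p (i + 1))) ∧
    (¬ (I.share.Adj i p ∧ s.arr 9 i = 0 ∧ s.arr 9 p = 0) →
      t.arr 9 = s.arr 9 ∧ t.arr 8 = s.arr 8) := by
  have hsh := h.share i p
  simp only [decodeStep, run_seq, run_branch, run_set, run_write, run_skip, eval_add, eval_entry,
    eval_read, eval_reg, eval_const, Store.setReg_reg, Store.setReg_arr, hi, h.regN,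
    Nat.reduceEqDiff, reduceIte, hp]
  by_cases c1 : I.share.Adj i p
  · have c1' := hsh.mpr c1
    by_cases c2 : s.arr 9 i = 0 ∧ s.arr 9 p = 0
    · by_cases c3 : s.arr 7 (n + i) = 0 <;>
        simp [c1, c1', c2, c3, Store.setReg_reg, Store.setReg_arr, Store.setArr_reg,
          Store.setArr_arr, hi, h.regN]
    · simp [c1, c1', c2, Store.setReg_arr]
  · have c1' : s.arr 2 (s.arr 5 i + p) = 0 := by
      by_contra hne
      exact c1 (hsh.mp hne)
    simp [c1, c1', Store.setReg_arr]

/-- The agents that occur in the pairing `g` are marked in `u`. -/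
def Marks (n : ℕ) (g u : ℕ → ℕ) : Prop :=
  ∀ j o : Fin n, g j = o + 1 → u j ≠ 0 ∧ u o ≠ 0

/-- Unmarked agents occur in no pair of `g`, so a new pair of them along a sharing edge conflicts
with nothing. -/
theorem IsPairing.update {g u u' : ℕ → ℕ} (hg : I.IsPairing g) (hu : Marks n g u) {j o : Fin n}
    (hjo : I.share.Adj o j) (hj : u j = 0) (ho : u o = 0)
    (hu' : ∀ x : Fin n, u' x ≠ 0 ↔ u x ≠ 0 ∨ x = j ∨ x = o) :
    I.IsPairing (Function.update g j (o + 1)) ∧ Marks n (Function.update g j (o + 1)) u' := by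
  have hself : Function.update g j (o + 1) j = o + 1 := Function.update_self ..
  have hother : ∀ x : Fin n, x ≠ j → Function.update g j (o + 1) x = g x := fun x hx =>
    Function.update_of_ne (fun h => hx (Fin.ext h)) ..
  have hoj : o ≠ j := hjo.ne
  have hg0 : ∀ x : Fin n, u x = 0 → g x = 0 := by
    intro x hx
    by_contra hne
    have := hg.le x
    exact (hu x ⟨g x - 1, by omega⟩ (by simp only []; omega)).1 hx
  have hgne : ∀ x y : Fin n, u y = 0 → g x ≠ y + 1 := fun x y hy hx => (hu x y hx).2 hy
  refine ⟨⟨fun x => ?_, fun x y hx => ?_, fun x y hx hxy => ?_, fun x y hx => ?_⟩,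
    fun x y hx => ?_⟩
  · by_cases hxj : x = j
    · rw [hxj, hself]; omega
    · rw [hother x hxj]; exact hg.le x
  · by_cases hxj : x = j
    · rw [hxj, hself] at hx
      obtain rfl : o = y := Fin.ext (by omega)
      rwa [hxj]
    · rw [hother x hxj] at hx
      exact hg.adj x y hx
  · by_cases hxj : x = j <;> by_cases hyj : y = j
    · rw [hxj, hyj]
    · rw [hxj, hself, hother y hyj] at hxy
      exact absurd hxy.symm (hgne y o ho)
    · rw [hyj, hself, hother x hxj] at hxy
      exact absurd hxy (hgne x o ho)
    · rw [hother x hxj] at hx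
      rw [hother x hxj, hother y hyj] at hxy
      exact hg.inj x y hx hxy
  · by_cases hxj : x = j
    · rw [hxj, hself] at hx
      obtain rfl : o = y := Fin.ext (by omega)
      rw [hother o hoj]
      exact hg0 o ho
    · rw [hother x hxj] at hx
      by_cases hyj : y = j
      · subst hyj
        exact absurd hx (hgne x y hj)
      · rw [hother y hyj]
        exact hg.giver x y hx
  · rw [hu', hu']
    by_cases hxj : x = j
    · rw [hxj, hself] at hx
      obtain rfl : o = y := Fin.ext (by omega)
      exact ⟨.inr (.inl hxj), .inr (.inr rfl)⟩
    · rw [hother x hxj] at hx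
      have := hu x y hx
      exact ⟨.inl this.1, .inl this.2⟩

theorem update_update_one_ne_zero (u : ℕ → ℕ) (i p : Fin n) (x : Fin n) :
    Function.update (Function.update u i 1) p 1 x ≠ 0 ↔ u x ≠ 0 ∨ x = i ∨ x = p := by
  by_cases hp : x = p
  · subst hp; simp
  · rw [Function.update_of_ne (fun h => hp (Fin.ext h))]
    by_cases hi : x = i
    · subst hi; simp
    · rw [Function.update_of_ne (fun h => hi (Fin.ext h))]
      simp [hp, hi]

/-- `g` is the part of the pairing `q` that meets the agents below `b`, and `u` marks the agents in
this part. -/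
structure Tracks (n : ℕ) (q : ℕ → ℕ) (b : ℕ) (g u : ℕ → ℕ) : Prop where
  -- As `q j` is the giver plus one, `q j ≤ b` says that the giver is below `b`; when `q j = 0` both
  -- branches give zero.
  pairs : ∀ j : Fin n, g j = if j < b ∨ q j ≤ b then q j else 0
  marks : ∀ x : Fin n, u x ≠ 0 ↔
    ∃ j o : Fin n, q j = o + 1 ∧ (x = j ∨ x = o) ∧ ((j : ℕ) < b ∨ (o : ℕ) < b)

/-- The pairs of a pairing are disjoint as sets of agents. -/
theorem IsPairing.eq_of_meet {q : ℕ → ℕ} (hq : I.IsPairing q) {j o j' o' x : Fin n}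
    (h : q j = o + 1) (h' : q j' = o' + 1) (hx : x = j ∨ x = o) (hx' : x = j' ∨ x = o') :
    j = j' ∧ o = o' := by
  have hj : j = j' := by
    rcases hx with rfl | rfl <;> rcases hx' with hx' | hx'
    · exact hx'
    · subst hx'
      have := hq.giver _ _ h'
      omega
    · subst hx'
      have := hq.giver _ _ h
      omega
    · subst hx'
      exact hq.inj _ _ (by omega) (by omega)
  subst hj
  exact ⟨rfl, Fin.ext (by omega)⟩

theorem Tracks.free {q g u : ℕ → ℕ} {b : ℕ} (ht : Tracks n q b g u) (hq : I.IsPairing q)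
    {j o x : Fin n} (hjo : q j = o + 1) (hj : b ≤ j) (ho : b ≤ o) (hx : x = j ∨ x = o) :
    u x = 0 := by
  by_contra hne
  obtain ⟨j', o', h', hx', hlt⟩ := (ht.marks x).mp hne
  obtain ⟨rfl, rfl⟩ := hq.eq_of_meet hjo h' hx hx'
  omega

theorem Tracks.step {q g u u' : ℕ → ℕ} {b : ℕ} (ht : Tracks n q b g u) (hq : I.IsPairing q)
    {j o : Fin n} (hjo : q j = o + 1) (hb : (j : ℕ) = b ∨ (o : ℕ) = b)
    (hu' : ∀ x : Fin n, u' x ≠ 0 ↔ u x ≠ 0 ∨ x = j ∨ x = o) :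
    Tracks n q (b + 1) (Function.update g j (o + 1)) u' := by
  obtain ⟨z, hz, hzjo⟩ : ∃ z : Fin n, (z : ℕ) = b ∧ (z = j ∨ z = o) := by
    rcases hb with hb | hb
    exacts [⟨j, hb, .inl rfl⟩, ⟨o, hb, .inr rfl⟩]
  constructor
  · intro x
    by_cases hx : x = j
    · subst hx
      rw [Function.update_self, if_pos (by omega), hjo]
    · rw [Function.update_of_ne (fun h => hx (Fin.ext h)), ht.pairs x]
      by_cases h0 : q x = 0
      · simp [h0]
      · have hle := hq.le x
        have hxo : q x = (⟨q x - 1, by omega⟩ : Fin n) + 1 := by simp only []; omega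
        have hne : ¬ (z = x ∨ z = (⟨q x - 1, by omega⟩ : Fin n)) := fun hh =>
          hx (hq.eq_of_meet hxo hjo hh hzjo).1
        simp only [Fin.ext_iff, hz] at hne
        have : (((x : ℕ) < b ∨ q x ≤ b) ↔ ((x : ℕ) < b + 1 ∨ q x ≤ b + 1)) := by omega
        simp only [this]
  · intro x
    rw [hu', ht.marks]
    constructor
    · rintro (⟨j', o', h', hx, hlt⟩ | hx)
      · exact ⟨j', o', h', hx, by omega⟩
      · exact ⟨j, o, hjo, hx, by omega⟩
    · rintro ⟨j', o', h', hx, hlt⟩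
      by_cases hlt' : (j' : ℕ) < b ∨ (o' : ℕ) < b
      · exact .inl ⟨j', o', h', hx, hlt'⟩
      · have hzz : z = j' ∨ z = o' := by
          simp only [Fin.ext_iff]
          omega
        obtain ⟨rfl, rfl⟩ := hq.eq_of_meet hjo h' hzjo hzz
        exact .inr hx

/-- This covers an agent `b` that is idle in `q` or was already entered with its smaller partner. -/
theorem Tracks.skip {q g u : ℕ → ℕ} {b : ℕ} (ht : Tracks n q b g u) (hq : I.IsPairing q)
    (hb : ∀ j o : Fin n, q j = o + 1 → (j : ℕ) = b ∨ (o : ℕ) = b → (j : ℕ) < b ∨ (o : ℕ) < b) :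
    Tracks n q (b + 1) g u := by
  constructor
  · intro x
    rw [ht.pairs x]
    by_cases h0 : q x = 0
    · simp [h0]
    · have hle := hq.le x
      have hxo : q x = (⟨q x - 1, by omega⟩ : Fin n) + 1 := by simp only []; omega
      have := hb x _ hxo
      simp only at this
      have : (((x : ℕ) < b ∨ q x ≤ b) ↔ ((x : ℕ) < b + 1 ∨ q x ≤ b + 1)) := by omega
      simp only [this]
  · intro x
    rw [ht.marks]
    constructor
    · rintro ⟨j', o', h', hx, hlt⟩
      exact ⟨j', o', h', hx, by omega⟩
    · rintro ⟨j', o', h', hx, hlt⟩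
      have := hb j' o' h'
      exact ⟨j', o', h', hx, by omega⟩

/-- The digits in `d` describe the pairing `q`. -/
structure Describes (n : ℕ) (d q : ℕ → ℕ) : Prop where
  -- A pair is stored at its smaller agent, with direction bit zero if that agent receives. Every
  -- other agent has distance zero and so points at itself.
  up : ∀ j o : Fin n, q j = o + 1 → j < o → j + d (n + n + j) = o ∧ d (n + j) = 0
  down : ∀ j o : Fin n, q j = o + 1 → o < j → o + d (n + n + o) = j ∧ d (n + o) ≠ 0
  none : ∀ i : Fin n, (∀ j o : Fin n, q j = o + 1 → ¬ (i = j ∧ j < o) ∧ ¬ (i = o ∧ o < j)) →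
    d (n + n + i) = 0

theorem Describes.trichotomy {d q : ℕ → ℕ} (hD : Describes n d q) (i : Fin n) :
    (∃ o : Fin n, q i = o + 1 ∧ i < o ∧ i + d (n + n + i) = o ∧ d (n + i) = 0) ∨
    (∃ j : Fin n, q j = i + 1 ∧ i < j ∧ i + d (n + n + i) = j ∧ d (n + i) ≠ 0) ∨
    (d (n + n + i) = 0 ∧
      ∀ j o : Fin n, q j = o + 1 → ¬ (i = j ∧ j < o) ∧ ¬ (i = o ∧ o < j)) := by
  by_cases h1 : ∃ o : Fin n, q i = o + 1 ∧ i < o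
  · obtain ⟨o, ho, hio⟩ := h1
    exact .inl ⟨o, ho, hio, hD.up i o ho hio⟩
  · by_cases h2 : ∃ j : Fin n, q j = i + 1 ∧ i < j
    · obtain ⟨j, hj, hij⟩ := h2
      exact .inr (.inl ⟨j, hj, hij, hD.down j i hj hij⟩)
    · have : ∀ j o : Fin n, q j = o + 1 → ¬ (i = j ∧ j < o) ∧ ¬ (i = o ∧ o < j) := by
        refine fun j o hjo => ⟨?_, ?_⟩
        · rintro ⟨rfl, hlt⟩
          exact h1 ⟨o, hjo, hlt⟩
        · rintro ⟨rfl, hlt⟩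
          exact h2 ⟨j, hjo, hlt⟩
      exact .inr (.inr ⟨hD.none i this, this⟩)

/-- Arbitrary digits must yield some pairing, for soundness; digits that describe `q` must yield `q`
itself, for completeness. -/
theorem Ready.decode_run (h : I.Ready s) (hd : ∀ i < n, i + s.arr 7 (n + n + i) < n) :
    let t := decode.run s
    I.IsPairing (t.arr 8) ∧ ∀ q, I.IsPairing q → Describes n (s.arr 7) q →
      ∀ j : Fin n, t.arr 8 j = q j := by
  have f1 := frame_run (.rep 6 0 (.seq (.write 8 (.reg 6) (.const 0))
    (.write 9 (.reg 6) (.const 0)))) s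
  have k1 := run_rep 6 0 (.seq (.write 8 (.reg 6) (.const 0)) (.write 9 (.reg 6) (.const 0))) s
    (fun b t => ∀ j < b, t.arr 8 j = 0 ∧ t.arr 9 j = 0) (by simp) (by
      intro b t hb hf hr hP j hj
      simp only [run_seq, run_write, eval_reg, eval_const, Store.setReg_arr, Store.setArr_arr,
        Store.setArr_reg, hr, Nat.reduceEqDiff, reduceIte]
      by_cases hjb : j = b
      · subst hjb; simp
      · rw [Function.update_of_ne hjb, Function.update_of_ne hjb]
        exact hP j (by omega))
  rw [h.regN] at k1
  simp only [decode, run_seq]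
  set s1 := (LProg.rep 6 0 (.seq (.write 8 (.reg 6) (.const 0))
    (.write 9 (.reg 6) (.const 0)))).run s
  have r1 : I.Ready s1 := h.frame f1 (by decide) (by decide)
  have e7 := f1.arr 7 (by decide)
  have key := run_rep 6 0 decodeStep s1
    (fun b t => I.IsPairing (t.arr 8) ∧ Marks n (t.arr 8) (t.arr 9) ∧
      ∀ q, I.IsPairing q → Describes n (s.arr 7) q → Tracks n q b (t.arr 8) (t.arr 9))
    (by
      simp only [Store.setReg_arr]
      have z8 : ∀ j : Fin n, s1.arr 8 j = 0 := fun j => (k1 j j.2).1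
      have z9 : ∀ j : Fin n, s1.arr 9 j = 0 := fun j => (k1 j j.2).2
      refine ⟨⟨?_, ?_, ?_, ?_⟩, ?_, fun q hq _ => ⟨?_, ?_⟩⟩
      · simp [z8]
      · simp [z8]
      · simp [z8]
      · simp [z8]
      · simp [Marks, z8]
      · intro j
        rw [z8]
        split_ifs with hc
        · omega
        · rfl
      · simp [z9])
    (by
      intro b t hb hf hr ⟨hp, hmk, htr⟩
      rw [r1.regN] at hb
      have ht : I.Ready t := r1.frame hf (by decide) (by decide)
      have f7 : t.arr 7 = s.arr 7 := (hf.arr 7 (by decide)).trans e7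
      have := ht.decodeStep_run (i := ⟨b, hb⟩) (p := ⟨_, hd b hb⟩) hr (by simp [f7])
      simp only [Store.setReg_arr]
      have hpval : b + s.arr 7 (n + n + b) = (⟨_, hd b hb⟩ : Fin n) := rfl
      generalize (⟨_, hd b hb⟩ : Fin n) = p at this hpval
      rw [f7] at this
      obtain ⟨hyes, hno⟩ := this
      by_cases c1 : I.share.Adj ⟨b, hb⟩ p ∧ t.arr 9 b = 0 ∧ t.arr 9 p = 0
      · obtain ⟨q9, q8⟩ := hyes c1
        obtain ⟨hadj, u1, u2⟩ := c1
        have hu := update_update_one_ne_zero (t.arr 9) ⟨b, hb⟩ p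
        rw [q9, q8]
        split_ifs with c2
        · have hpair := hp.update hmk (j := ⟨b, hb⟩) (o := p) hadj.symm u1 u2 hu
          refine ⟨hpair.1, hpair.2, fun q hq hD => ?_⟩
          rcases hD.trichotomy ⟨b, hb⟩ with ⟨o, ho, -, hbo, -⟩ | ⟨j, -, -, -, hne⟩ | ⟨h0, -⟩
          · obtain rfl : p = o := Fin.ext (by simp only [] at hbo; omega)
            exact (htr q hq hD).step hq ho (.inl rfl) hu
          · exact absurd c2 hne
          -- Distance zero makes the agent its own partner, and the sharing graph has no loops.
          · obtain rfl : p = ⟨b, hb⟩ := Fin.ext (by simp only [] at h0 ⊢; omega)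
            exact absurd rfl hadj.ne
        · have hpair := hp.update hmk (j := p) (o := ⟨b, hb⟩) hadj u2 u1
            (fun x => by rw [hu, or_comm (a := x = p)])
          refine ⟨hpair.1, hpair.2, fun q hq hD => ?_⟩
          rcases hD.trichotomy ⟨b, hb⟩ with ⟨o, -, -, -, h0⟩ | ⟨j, hj, -, hbj, -⟩ | ⟨h0, -⟩
          · exact absurd h0 c2
          · obtain rfl : p = j := Fin.ext (by simp only [] at hbj; omega)
            exact (htr q hq hD).step hq hj (.inr rfl)
              (fun x => by rw [hu, or_comm (a := x = p)])
          · obtain rfl : p = ⟨b, hb⟩ := Fin.ext (by simp only [] at h0 ⊢; omega)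
            exact absurd rfl hadj.ne
      · obtain ⟨q9, q8⟩ := hno c1
        rw [q9, q8]
        refine ⟨hp, hmk, fun q hq hD => ?_⟩
        have hT := htr q hq hD
        rcases hD.trichotomy ⟨b, hb⟩ with ⟨o, ho, hlt, hbo, -⟩ | ⟨j, hj, hlt, hbj, -⟩ | ⟨-, h0⟩
        · obtain rfl : p = o := Fin.ext (by simp only [] at hbo; omega)
          -- A pair of `q` stored at `b` cannot have been refused: its ends are neighbours, and
          -- neither was marked earlier.
          exact absurd ⟨(hq.adj _ _ ho).symm, hT.free hq ho le_rfl (le_of_lt hlt) (.inl rfl),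
            hT.free hq ho le_rfl (le_of_lt hlt) (.inr rfl)⟩ c1
        · obtain rfl : p = j := Fin.ext (by simp only [] at hbj; omega)
          exact absurd ⟨hq.adj _ _ hj, hT.free hq hj (le_of_lt hlt) le_rfl (.inr rfl),
            hT.free hq hj (le_of_lt hlt) le_rfl (.inl rfl)⟩ c1
        · refine hT.skip hq fun j o hjo hb' => ?_
          have hne := (hq.adj j o hjo).ne
          have := h0 j o hjo
          simp only [Fin.ext_iff, Fin.lt_def] at this hne
          omega)
  rw [r1.regN] at key
  refine ⟨key.1, fun q hq hD j => ?_⟩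
  have := (key.2.2 q hq hD).pairs j
  rwa [if_pos (.inl j.2)] at this

end Instance

/-! ## Enumeration of digit vectors -/

/-- The place value of digit `x`. -/
def place (n x : ℕ) : ℕ := ∏ y ∈ Finset.range x, radix n y

/-- Digit `x` of the number `c`. -/
def digit (n c x : ℕ) : ℕ := c / place n x % radix n x

theorem place_succ (n x : ℕ) : place n (x + 1) = place n x * radix n x :=
  Finset.prod_range_succ ..

theorem radix_pos {n x : ℕ} (hx : x < n + n + n) : 0 < radix n x := by
  unfold radix
  split_ifs <;> omega

theorem place_pos {n x : ℕ} (hx : x ≤ n + n + n) : 0 < place n x :=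
  Finset.prod_pos fun y hy => radix_pos (by rw [Finset.mem_range] at hy; omega)

theorem exists_digit_eq {n : ℕ} {d : ℕ → ℕ} (hd : ∀ x < n + n + n, d x < radix n x) :
    ∀ b ≤ n + n + n, ∃ c < place n b, ∀ x < b, digit n c x = d x := by
  intro b hb
  induction b with
  | zero => exact ⟨0, place_pos hb, by simp⟩
  | succ b ih =>
    obtain ⟨c, hc, h⟩ := ih (by omega)
    have hpos : 0 < place n b := place_pos (by omega)
    have hdb := hd b (by omega)
    -- Mixed radix expansion: the new leading digit does not disturb the lower ones.
    refine ⟨c + place n b * d b, ?_, fun x hx => ?_⟩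
    · rw [place_succ]
      calc c + place n b * d b < place n b + place n b * d b := by omega
        _ = place n b * (d b + 1) := by ring
        _ ≤ place n b * radix n b := Nat.mul_le_mul_left _ hdb
    · by_cases hxb : x = b
      · subst hxb
        rw [digit, Nat.add_mul_div_left _ _ hpos, Nat.div_eq_of_lt hc, zero_add,
          Nat.mod_eq_of_lt hdb]
      · have hxb' : x + 1 ≤ b := by omega
        obtain ⟨q, hq⟩ : place n (x + 1) ∣ place n b :=
          Finset.prod_dvd_prod_of_subset _ _ _ (Finset.range_subset_range.mpr hxb')
        rw [← h x (by omega), digit, digit, hq, place_succ,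
          show c + place n x * radix n x * q * d b = c + place n x * (radix n x * (q * d b)) by
            ring, Nat.add_mul_div_left _ _ (place_pos (by omega)), Nat.add_mul_mod_self_left]

/-- Divisibility of `c + 1` by the place value expresses that a carry arrives at position `x` when
`c` is incremented; the two cases say whether it passes on. -/
theorem digit_succ_of_dvd {n c x : ℕ} (hx : x < n + n + n) (h : place n x ∣ c + 1) :
    (digit n c x + 1 < radix n x → digit n (c + 1) x = digit n c x + 1 ∧
      ¬ place n (x + 1) ∣ c + 1) ∧
    (¬ digit n c x + 1 < radix n x → digit n (c + 1) x = 0 ∧ place n (x + 1) ∣ c + 1) := by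
  have hr := radix_pos hx
  have hp : 0 < place n x := place_pos hx.le
  obtain ⟨q, hq⟩ := h
  have hdiv : (c + 1) / place n x = q := by rw [hq, Nat.mul_div_cancel_left _ hp]
  have hsucc : c / place n x + 1 = q := by
    rw [← hdiv, Nat.succ_div_of_dvd ⟨q, hq⟩]
  have hdvd : place n (x + 1) ∣ c + 1 ↔ radix n x ∣ q := by
    rw [place_succ, hq, Nat.mul_dvd_mul_iff_left hp]
  rw [hdvd, digit, digit, hdiv, ← hsucc]
  have hlt := Nat.mod_lt (c / place n x) hr
  constructor
  · intro h
    have : (c / place n x + 1) % radix n x = c / place n x % radix n x + 1 := by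
      rw [Nat.add_mod, Nat.mod_eq_of_lt (a := 1) (by omega), Nat.mod_eq_of_lt h]
    refine ⟨this, fun hd => ?_⟩
    have := Nat.mod_eq_zero_of_dvd hd
    omega
  · intro h
    have hd : radix n x ∣ c / place n x + 1 := by
      have h1 := Nat.div_add_mod (c / place n x) (radix n x)
      have h2 : c / place n x % radix n x + 1 = radix n x := by omega
      exact ⟨c / place n x / radix n x + 1, by rw [mul_add, mul_one]; omega⟩
    exact ⟨Nat.mod_eq_zero_of_dvd hd, hd⟩

theorem digit_succ_of_not_dvd {n c x : ℕ} (h : ¬ place n x ∣ c + 1) :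
    digit n (c + 1) x = digit n c x ∧ ¬ place n (x + 1) ∣ c + 1 := by
  refine ⟨by rw [digit, digit, Nat.succ_div_of_not_dvd h], fun h' => h ?_⟩
  rw [place_succ] at h'
  exact dvd_of_mul_right_dvd h'

/-- One step of the increment of the digits. -/
def incrementStep : LProg :=
  .branch (.reg 18) (.branch (.read 6 (.reg 20) - (.read 7 (.reg 20) + .const 1))
    (.seq (.write 7 (.reg 20) (.read 7 (.reg 20) + .const 1)) (.set 18 (.const 0)))
    (.write 7 (.reg 20) (.const 0))) .skip

/-- Go to the next digit vector. -/
def increment : LProg := .seq (.set 18 (.const 1)) (.rep 20 3 incrementStep)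

/-- Treat all resources as alive. -/
def revive : LProg := .rep 8 1 (.write 10 (.reg 8 + .const 1) (.const 0))

/-- Examine the current digit vector and go to the next one. -/
def config : LProg := .seq decode (.seq revive (.seq rounds increment))

/-- Examine all digit vectors. -/
def enumerate : LProg := .rep 9 4 config

namespace Instance

variable {n m : ℕ} {I : Instance n m} {s : Store}

theorem Ready.increment_run (h : I.Ready s) {c : ℕ}
    (hc : ∀ x < n + n + n, s.arr 7 x = digit n c x) :
    ∀ x < n + n + n, (increment.run s).arr 7 x = digit n (c + 1) x := by
  classical
  have hs1 : I.Ready (s.setReg 18 1) :=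
    h.frame (frame_run (.set 18 (.const 1)) s) (by decide) (by decide)
  have key := run_rep 20 3 incrementStep (s.setReg 18 1)
    -- The carry register records this divisibility; positions below `b` already show `c + 1`, the
    -- others still `c`.
    (fun b t => t.reg 18 = (if place n b ∣ c + 1 then 1 else 0) ∧
      (∀ x < b, t.arr 7 x = digit n (c + 1) x) ∧
      ∀ x < n + n + n, b ≤ x → t.arr 7 x = digit n c x)
    (by
      refine ⟨by simp [Store.setReg_reg, place], by simp, fun x hx _ => hc x hx⟩)
    (by
      intro b t hb hf hr ⟨h18, hlo, hhi⟩
      rw [hs1.regL] at hb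
      have ht : I.Ready t := hs1.frame hf (by decide) (by decide)
      have hrad := ht.rad b hb
      have hdig := hhi b hb le_rfl
      simp only [incrementStep, run_branch, run_seq, run_set, run_write, run_skip, eval_sub,
        eval_add, eval_read, eval_reg, eval_const, hr, hrad, hdig, Store.setReg_arr]
      by_cases h1 : place n b ∣ c + 1
      · rw [if_pos h1] at h18
        obtain ⟨hA, hB⟩ := digit_succ_of_dvd hb h1
        rw [if_neg (by omega)]
        by_cases h2 : digit n c b + 1 < radix n b
        · obtain ⟨e1, e2⟩ := hA h2
          rw [if_neg (by omega), if_neg e2]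
          simp only [Store.setReg_reg, Store.setReg_arr, Store.setArr_arr, Nat.reduceEqDiff,
            reduceIte, Function.update_apply]
          refine ⟨trivial, fun x hx => ?_, fun x hx hbx => ?_⟩
          · split_ifs with hxb
            · rw [hxb, e1]
            · exact hlo x (by omega)
          · rw [if_neg (by omega)]
            exact hhi x hx (by omega)
        · obtain ⟨e1, e2⟩ := hB h2
          rw [if_pos (by omega), if_pos e2]
          simp only [Store.setReg_reg, Store.setArr_reg, Store.setArr_arr, Nat.reduceEqDiff,
            reduceIte, Function.update_apply]
          refine ⟨h18, fun x hx => ?_, fun x hx hbx => ?_⟩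
          · split_ifs with hxb
            · rw [hxb, e1]
            · exact hlo x (by omega)
          · rw [if_neg (by omega)]
            exact hhi x hx (by omega)
      · rw [if_neg h1] at h18
        obtain ⟨e1, e2⟩ := digit_succ_of_not_dvd h1
        rw [if_pos h18, if_neg e2]
        simp only [Store.setReg_reg, Nat.reduceEqDiff, reduceIte]
        refine ⟨h18, fun x hx => ?_, fun x hx hbx => hhi x hx (by omega)⟩
        by_cases hxb : x = b
        · rw [hxb, hdig, e1]
        · exact hlo x (by omega))
  rw [hs1.regL] at key
  exact key.2.1

theorem Ready.revive_run (h : I.Ready s) (r : Fin m) : (revive.run s).arr 10 (r + 1) = 0 := by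
  have key := run_rep 8 1 (.write 10 (.reg 8 + .const 1) (.const 0)) s
    (fun b t => ∀ r < b, t.arr 10 (r + 1) = 0) (by simp) (by
      intro b t hb hf hr hP r hrb
      simp only [run_write, eval_add, eval_reg, eval_const, Store.setReg_arr, Store.setArr_arr,
        reduceIte, Function.update_apply, hr]
      split_ifs with hc
      · rfl
      · exact hP r (by omega))
  rw [h.regM] at key
  exact key r r.2

/-- The digits describe a solution: who must not be envious, and who gives to whom. -/
structure Solution (I : Instance n m) (d : ℕ → ℕ) (q Q : ℕ → ℕ) : Prop where
  pairing : I.IsPairing q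
  legal : I.IsLegal q Q
  few : (I.pickEnvious Q).card ≤ I.k
  bits : ∀ i : Fin n, d i ≠ 0 ↔ i ∉ I.pickEnvious Q
  describes : Describes n d q

theorem Ready.config_run (h : I.Ready s) {c : ℕ}
    (hc : ∀ x < n + n + n, s.arr 7 x = digit n c x) :
    let t := config.run s
    (∀ x < n + n + n, t.arr 7 x = digit n (c + 1) x) ∧
      (t.reg 5 = s.reg 5 ∨ (t.reg 5 = 1 ∧ I.IsYes)) ∧
      ∀ q Q, I.Solution (s.arr 7) q Q → t.reg 5 = 1 := by
  -- The distance digit of agent `i` has radix `n - i`, so the partner is an agent.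
  have hd : ∀ i < n, i + s.arr 7 (n + n + i) < n := by
    intro i hi
    have hlt := Nat.mod_lt (c / place n (n + n + i)) (radix_pos (n := n) (x := n + n + i) (by omega))
    rw [hc _ (by omega), digit]
    rw [radix, if_neg (by omega)] at hlt ⊢
    omega
  obtain ⟨hp, hq⟩ := h.decode_run hd
  have f1 := frame_run decode s
  have h1 : I.Ready (decode.run s) := h.frame f1 (by decide) (by decide)
  simp only [config, run_seq]
  set s1 := decode.run s
  have hdead := h1.revive_run
  have f2 := frame_run revive s1
  have h2 : I.Ready (revive.run s1) := h1.frame f2 (by decide) (by decide)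
  set s2 := revive.run s1
  have e8 := f2.arr 8 (by decide)
  have e5 := (f2.reg 5 (by decide)).trans (f1.reg 5 (by decide))
  have hp2 : I.IsPairing (s2.arr 8) := by rw [e8]; exact hp
  have hsound := h2.rounds_sound hp2
  have f3 := frame_run rounds s2
  have h3 : I.Ready (rounds.run s2) := h2.frame f3 (by decide) (by decide)
  have e7 := (f2.arr 7 (by decide)).trans (f1.arr 7 (by decide))
  have e7' := (f3.arr 7 (by decide)).trans e7
  have f4 := frame_run increment (rounds.run s2)
  refine ⟨h3.increment_run (by rw [e7']; exact hc), ?_, fun q Q hQ => ?_⟩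
  · rw [f4.reg 5 (by decide), ← e5]
    exact hsound
  · rw [f4.reg 5 (by decide)]
    have hgq := hq q hQ.pairing hQ.describes
    refine h2.rounds_complete hp2 (Q := Q) (fun j => ?_) hQ.few (by rw [e7]; exact hQ.bits) hdead
    rw [e8]
    refine (hQ.legal j).imp_right ?_
    rintro ⟨r, hr, o, ho, hor⟩
    exact ⟨r, hr, o, by rw [hgq, ho], hor⟩

theorem exists_solution_digits (h : I.IsYes) :
    ∃ d q Q : ℕ → ℕ, (∀ x < n + n + n, d x < radix n x) ∧ I.Solution d q Q := by
  classical
  obtain ⟨q, Q, hq, hQ, hk⟩ := exists_pick_of_isYes h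
  let bit : ℕ → ℕ := fun i => if ∃ x : Fin n, x = i ∧ x ∈ I.pickEnvious Q then 0 else 1
  let dir : ℕ → ℕ := fun i => if ∃ j : Fin n, q j = i + 1 ∧ i < j then 1 else 0
  -- The alternative is the distance to a larger giver; by truncation it is zero if the giver is
  -- smaller or absent.
  let dist : ℕ → ℕ := fun i => if hj : ∃ j : Fin n, q j = i + 1 ∧ i < j then hj.choose - i
    else q i - 1 - i
  let d : ℕ → ℕ := fun x => if x < n then bit x else if x < n + n then dir (x - n)
    else dist (x - (n + n))
  have d1 : ∀ i < n, d i = bit i := fun i hi => by simp only [d, if_pos hi]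
  have d2 : ∀ i < n, d (n + i) = dir i := fun i hi => by
    simp only [d, if_neg (show ¬ n + i < n by omega), if_pos (show n + i < n + n by omega),
      Nat.add_sub_cancel_left]
  have d3 : ∀ i, d (n + n + i) = dist i := fun i => by
    simp only [d, if_neg (show ¬ n + n + i < n by omega),
      if_neg (show ¬ n + n + i < n + n by omega), Nat.add_sub_cancel_left]
  have hdown : ∀ j o : Fin n, q j = o + 1 → o < j → dist o = j - o ∧ dir o = 1 := by
    intro j o hjo hlt
    have hx : ∃ j : Fin n, q j = o + 1 ∧ (o : ℕ) < j := ⟨j, hjo, hlt⟩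
    have hjj : hx.choose = j := hq.inj _ _ (by rw [hx.choose_spec.1]; omega)
      (by rw [hx.choose_spec.1, hjo])
    exact ⟨by simp only [dist, dif_pos hx, hjj], by simp only [dir, if_pos hx]⟩
  have hup : ∀ i : Fin n, (∀ j : Fin n, q j = i + 1 → ¬ i < j) →
      dist i = q i - 1 - i ∧ dir i = 0 := by
    intro i hi
    have hx : ¬ ∃ j : Fin n, q j = i + 1 ∧ (i : ℕ) < j := fun ⟨j, hj, hlt⟩ => hi j hj hlt
    exact ⟨by simp only [dist, dif_neg hx], by simp only [dir, if_neg hx]⟩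
  refine ⟨d, q, Q, fun x hx => ?_, hq, hQ, hk, fun i => ?_, ?_, ?_, ?_⟩
  · by_cases h1 : x < n
    · rw [d1 x h1, radix, if_pos (by omega)]
      simp only [bit]
      split_ifs <;> omega
    · by_cases h2 : x < n + n
      · obtain ⟨i, rfl⟩ := Nat.exists_eq_add_of_le (not_lt.mp h1)
        rw [d2 i (by omega), radix, if_pos (by omega)]
        simp only [dir]
        split_ifs <;> omega
      · obtain ⟨i, rfl⟩ := Nat.exists_eq_add_of_le (not_lt.mp h2)
        rw [d3 i, radix, if_neg (by omega)]
        by_cases hj : ∃ j : Fin n, q j = i + 1 ∧ i < j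
        · obtain ⟨j, hj, hij⟩ := hj
          rw [(hdown j ⟨i, by omega⟩ hj hij).1]
          simp only
          omega
        · rw [(hup ⟨i, by omega⟩ fun j hj' hlt => hj ⟨j, hj', hlt⟩).1]
          have := hq.le ⟨i, by omega⟩
          simp only at this ⊢
          omega
  · rw [d1 i i.2]
    simp only [bit]
    by_cases hi : i ∈ I.pickEnvious Q
    · simp [hi, show ∃ x : Fin n, (x : ℕ) = i ∧ x ∈ I.pickEnvious Q from ⟨i, rfl, hi⟩]
    · have : ¬ ∃ x : Fin n, (x : ℕ) = i ∧ x ∈ I.pickEnvious Q := by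
        rintro ⟨x, hx, hx'⟩
        exact hi (Fin.ext hx ▸ hx')
      simp [hi, this]
  · intro j o hjo hlt
    rw [d3, d2 _ j.2]
    have := hup j fun j' hj' _ => by
      have := hq.giver _ _ hj'
      omega
    rw [this.1, this.2, hjo]
    rw [Fin.lt_def] at hlt
    exact ⟨by omega, rfl⟩
  · intro j o hjo hlt
    rw [d3, d2 _ o.2]
    have := hdown j o hjo hlt
    rw [this.1, this.2]
    rw [Fin.lt_def] at hlt
    exact ⟨by omega, one_ne_zero⟩
  · intro i hi
    rw [d3, (hup i fun j hj hlt => (hi j i hj).2 ⟨rfl, hlt⟩).1]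
    by_contra hne
    have hle := hq.le i
    exact (hi i ⟨q i - 1, by omega⟩ (by simp only []; omega)).1
      ⟨rfl, by rw [Fin.lt_def]; simp only []; omega⟩

theorem Ready.enumerate_run (h : I.Ready s) (h4 : s.reg 4 = place n (n + n + n))
    (h5 : s.reg 5 = 0) (h7 : ∀ x, s.arr 7 x = 0) :
    let t := enumerate.run s
    (I.IsYes → t.reg 5 = 1) ∧ (¬ I.IsYes → t.reg 5 = 0) := by
  have key := run_rep 9 4 config s
    (fun b t => (∀ x < n + n + n, t.arr 7 x = digit n b x) ∧
      (t.reg 5 = 0 ∨ (t.reg 5 = 1 ∧ I.IsYes)) ∧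
      ∀ c < b, ∀ d q Q : ℕ → ℕ, (∀ x < n + n + n, digit n c x = d x) → I.Solution d q Q →
        t.reg 5 = 1)
    (by
      simp only [Store.setReg_arr, Store.setReg_reg, Nat.reduceEqDiff, reduceIte, h5, h7]
      exact ⟨fun x hx => by simp [digit], .inl trivial, by simp⟩)
    (by
      intro b t hb hf hr ⟨hA, hB, hC⟩
      have ht : I.Ready t := h.frame hf (by decide) (by decide)
      obtain ⟨k1, k2, k3⟩ := ht.config_run hA
      simp only [Store.setReg_arr, Store.setReg_reg, Nat.reduceEqDiff, reduceIte]
      refine ⟨k1, ?_, fun c hc d q Q hd hS => ?_⟩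
      · rcases k2 with k2 | k2
        · rw [k2]; exact hB
        · exact .inr k2
      · by_cases hcb : c = b
        · subst hcb
          -- A solution depends only on the digits at positions below `3 * n`, where `d` and array 7
          -- agree.
          refine k3 q Q ⟨hS.pairing, hS.legal, hS.few, fun i => ?_, ?_⟩
          · rw [hA _ (by omega), hd _ (by omega)]
            exact hS.bits i
          · have e : ∀ x < n + n + n, t.arr 7 x = d x := fun x hx => (hA x hx).trans (hd x hx)
            have hD := hS.describes
            refine ⟨fun j o hjo hlt => ?_, fun j o hjo hlt => ?_, fun i hi => ?_⟩
            · rw [e _ (by omega), e _ (by omega)]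
              exact hD.up j o hjo hlt
            · rw [e _ (by omega), e _ (by omega)]
              exact hD.down j o hjo hlt
            · rw [e _ (by omega)]
              exact hD.none i hi
        · have h1 := hC c (by omega) d q Q hd hS
          rcases k2 with k2 | k2
          · rw [k2, h1]
          · exact k2.1)
  rw [h4] at key
  obtain ⟨-, hB, hC⟩ := key
  refine ⟨fun hy => ?_, fun hn => ?_⟩
  · obtain ⟨d, q, Q, hd, hS⟩ := exists_solution_digits hy
    obtain ⟨c, hc, hcd⟩ := exists_digit_eq hd _ le_rfl
    exact hC c hc d q Q hcd hS
  · rcases hB with hB | hB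
    · exact hB
    · exact absurd hB.2 hn

end Instance

/-! ## The algorithm -/

/-- Compute the loop bounds. -/
def prepare : LProg :=
  .seq (.set 11 (.reg 1 + .const 1)) (.seq (.set 3 (.reg 0 + .reg 0 + .reg 0))
    (.set 19 (.reg 0 + .const 2)))

/-- Compute the row positions. -/
def rows : LProg :=
  .rep 6 0 (.seq (.write 4 (.reg 6) (.reg 21)) (.seq (.write 5 (.reg 6) (.reg 22))
    (.seq (.set 21 (.reg 21 + .reg 1)) (.set 22 (.reg 22 + .reg 0)))))

/-- Compute the radices. -/
def radices : LProg :=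
  .rep 20 3 (.branch (.reg 0 + .reg 0 - .reg 20) (.write 6 (.reg 20) (.const 2))
    (.write 6 (.reg 20) (.reg 3 - .reg 20)))

/-- Multiply register 4 by the radix at position (register 20). -/
def multiply : LProg :=
  -- Repeated addition replaces the product. The loop bound is `n + 2`, which no radix exceeds, and
  -- the test stops adding once the radix is reached.
  .seq (.set 23 (.const 0)) (.seq (.rep 6 19 (.branch (.read 6 (.reg 20) - .reg 6)
    (.set 23 (.reg 23 + .reg 4)) .skip)) (.set 4 (.reg 23)))

/-- Compute the number of digit vectors. -/
def count : LProg := .seq (.set 4 (.const 1)) (.rep 20 3 multiply)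

/-- Compute all tables. -/
def tables : LProg := .seq rows (.seq radices count)

/-- The algorithm for Envy Reducing Sharing Allocation. -/
def algorithm : Prog :=
  .seq prepare.toProg (.seq tables.toProg (.seq enumerate.toProg (.set 0 (.reg 5))))

theorem rowMajor_apply {a b : ℕ} (f : Fin a → Fin b → ℕ) (i : Fin a) (j : Fin b) :
    rowMajor f (i * b + j) = f i j := by
  have he : (i : ℕ) * b + j = (finProdFinEquiv (i, j) : Fin (a * b)) := by
    simp [finProdFinEquiv, mul_comm, add_comm]
  rw [rowMajor, dif_pos (by rw [he]; exact Fin.is_lt _)]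
  have : (⟨i * b + j, by rw [he]; exact Fin.is_lt _⟩ : Fin (a * b)) = finProdFinEquiv (i, j) :=
    Fin.ext he
  rw [this, Equiv.symm_apply_apply]

theorem rows_run (s : Store) (h21 : s.reg 21 = 0) (h22 : s.reg 22 = 0) :
    ∀ i < s.reg 0, (rows.run s).arr 4 i = i * s.reg 1 ∧ (rows.run s).arr 5 i = i * s.reg 0 := by
  have key := run_rep 6 0 (.seq (.write 4 (.reg 6) (.reg 21)) (.seq (.write 5 (.reg 6) (.reg 22))
    (.seq (.set 21 (.reg 21 + .reg 1)) (.set 22 (.reg 22 + .reg 0))))) s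
    (fun b t => t.reg 21 = b * s.reg 1 ∧ t.reg 22 = b * s.reg 0 ∧
      ∀ i < b, t.arr 4 i = i * s.reg 1 ∧ t.arr 5 i = i * s.reg 0)
    (by simp [Store.setReg_reg, h21, h22]) (by
      intro b t hb hf hr ⟨h1, h2, h3⟩
      have e0 := hf.reg 0 (by decide)
      have e1 := hf.reg 1 (by decide)
      simp only [run_seq, run_set, run_write, eval_add, eval_reg, Store.setReg_reg,
        Store.setReg_arr, Store.setArr_reg, Store.setArr_arr, Nat.reduceEqDiff, reduceIte, hr, h1,
        h2, e0, e1, OfNat.zero_ne_ofNat, Function.update_apply]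
      refine ⟨by ring, by ring, fun i hi => ?_⟩
      by_cases hib : i = b
      · simp [hib]
      · simp only [hib, if_false]
        exact h3 i (by omega))
  exact key.2.2

theorem radices_run {n : ℕ} (s : Store) (h0 : s.reg 0 = n) (h3 : s.reg 3 = n + n + n) :
    ∀ x < n + n + n, (radices.run s).arr 6 x = radix n x := by
  have key := run_rep 20 3 (.branch (.reg 0 + .reg 0 - .reg 20) (.write 6 (.reg 20) (.const 2))
    (.write 6 (.reg 20) (.reg 3 - .reg 20))) s (fun b t => ∀ x < b, t.arr 6 x = radix n x)
    (by simp) (by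
      intro b t hb hf hr hP x hx
      have e0 := (hf.reg 0 (by decide)).trans h0
      have e3 := (hf.reg 3 (by decide)).trans h3
      simp only [run_branch, run_write, eval_add, eval_sub, eval_reg, eval_const, e0, e3, hr,
        Store.setReg_arr]
      by_cases hxb : x = b
      · subst hxb
        rw [radix]
        by_cases hc : n + n - x = 0
        · rw [if_pos hc, if_neg (by omega)]
          simp [Store.setArr_arr]
        · rw [if_neg hc, if_pos (by omega)]
          simp [Store.setArr_arr]
      · have := hP x (by omega)
        split_ifs <;> simp [Store.setArr_arr, hxb, this])
  rw [h3] at key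
  exact key

theorem multiply_run (s : Store) (hle : s.arr 6 (s.reg 20) ≤ s.reg 19) :
    (multiply.run s).reg 4 = s.reg 4 * s.arr 6 (s.reg 20) := by
  have key := run_rep 6 19 (.branch (.read 6 (.reg 20) - .reg 6)
    (.set 23 (.reg 23 + .reg 4)) .skip) (s.setReg 23 0)
    (fun b t => t.reg 23 = s.reg 4 * min b (s.arr 6 (s.reg 20)))
    (by simp [Store.setReg_reg]) (by
      intro b t hb hf hr hP
      have e20 : t.reg 20 = s.reg 20 := hf.reg 20 (by decide)
      have e4 : t.reg 4 = s.reg 4 := hf.reg 4 (by decide)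
      have e6 : t.arr 6 = s.arr 6 := hf.arr 6 (by decide)
      simp only [run_branch, run_set, run_skip, eval_add, eval_sub, eval_reg, eval_read, e20, e4,
        e6, hr]
      split_ifs with hc
      · simp only [Store.setReg_reg, Nat.reduceEqDiff, reduceIte]
        rw [hP, min_eq_right (by omega), min_eq_right (by omega)]
      · simp only [Store.setReg_reg, Nat.reduceEqDiff, reduceIte]
        rw [hP, min_eq_left (by omega), min_eq_left (by omega)]
        ring)
  simp only [multiply, run_seq, run_set, eval_const, eval_reg]
  have e19 : (s.setReg 23 0).reg 19 = s.reg 19 := by simp [Store.setReg_reg]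
  rw [e19, min_eq_right hle] at key
  simpa [Store.setReg_reg] using key

theorem radix_le (n x : ℕ) : radix n x ≤ n + 2 := by
  unfold radix
  split_ifs <;> omega

theorem count_run {n : ℕ} (s : Store) (h3 : s.reg 3 = n + n + n) (h19 : s.reg 19 = n + 2)
    (h6 : ∀ x < n + n + n, s.arr 6 x = radix n x) :
    (count.run s).reg 4 = place n (n + n + n) := by
  have key := run_rep 20 3 multiply (s.setReg 4 1) (fun b t => t.reg 4 = place n b)
    (by simp [Store.setReg_reg, place]) (by
      intro b t hb hf hr hP
      have e3 : (s.setReg 4 1).reg 3 = n + n + n := by simpa [Store.setReg_reg] using h3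
      rw [e3] at hb
      have e19 : t.reg 19 = n + 2 := (hf.reg 19 (by decide)).trans h19
      have e6 : t.arr 6 = s.arr 6 := hf.arr 6 (by decide)
      have hrad : t.arr 6 (t.reg 20) = radix n b := by rw [e6, hr, h6 b hb]
      have := multiply_run t (by rw [hrad, e19]; exact radix_le n b)
      simp only [Store.setReg_reg, Nat.reduceEqDiff, reduceIte]
      rw [this, hP, hrad, place_succ])
  have e3 : (s.setReg 4 1).reg 3 = n + n + n := by simpa [Store.setReg_reg] using h3
  rw [e3] at key
  exact key

namespace Instance

variable {n m : ℕ} (I : Instance n m)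

theorem ready_tables : I.Ready (tables.run (prepare.run I.input)) ∧
    (tables.run (prepare.run I.input)).reg 4 = place n (n + n + n) ∧
    (tables.run (prepare.run I.input)).reg 5 = 0 ∧
    ∀ x, (tables.run (prepare.run I.input)).arr 7 x = 0 := by
  have f0 := frame_run prepare I.input
  have p3 : (prepare.run I.input).reg 3 = n + n + n := by
    simp [prepare, run_seq, run_set, Store.setReg_reg, eval_add, eval_reg, eval_const, input]
  have p11 : (prepare.run I.input).reg 11 = m + 1 := by
    simp [prepare, run_seq, run_set, Store.setReg_reg, eval_add, eval_reg, eval_const, input]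
  have p19 : (prepare.run I.input).reg 19 = n + 2 := by
    simp [prepare, run_seq, run_set, Store.setReg_reg, eval_add, eval_reg, eval_const, input]
  set s := prepare.run I.input
  have p0 : s.reg 0 = n := f0.reg 0 (by decide)
  have p1 : s.reg 1 = m := f0.reg 1 (by decide)
  have hrows := rows_run s (f0.reg 21 (by decide)) (f0.reg 22 (by decide))
  rw [p0, p1] at hrows
  have f1 := frame_run rows s
  have e0 := (f1.reg 0 (by decide)).trans p0
  have e3 := (f1.reg 3 (by decide)).trans p3
  have hrad := radices_run (rows.run s) e0 e3
  have f2 := frame_run radices (rows.run s)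
  have hcount := count_run (radices.run (rows.run s)) ((f2.reg 3 (by decide)).trans e3)
    ((f2.reg 19 (by decide)).trans ((f1.reg 19 (by decide)).trans p19)) hrad
  have f3 := frame_run count (radices.run (rows.run s))
  have ht : tables.run s = count.run (radices.run (rows.run s)) := rfl
  have ft := frame_run tables s
  have a4 : ∀ i < n, (tables.run s).arr 4 i = i * m := fun i hi => by
    rw [ht, f3.arr 4 (by decide), f2.arr 4 (by decide), (hrows i hi).1]
  have a5 : ∀ i < n, (tables.run s).arr 5 i = i * n := fun i hi => by
    rw [ht, f3.arr 5 (by decide), f2.arr 5 (by decide), (hrows i hi).2]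
  have a6 : (tables.run s).arr 6 = (radices.run (rows.run s)).arr 6 := f3.arr 6 (by decide)
  have i0 : (tables.run s).arr 0 = I.input.arr 0 :=
    (ft.arr 0 (by decide)).trans (f0.arr 0 (by decide))
  have i1 : (tables.run s).arr 1 = I.input.arr 1 :=
    (ft.arr 1 (by decide)).trans (f0.arr 1 (by decide))
  have i2 : (tables.run s).arr 2 = I.input.arr 2 :=
    (ft.arr 2 (by decide)).trans (f0.arr 2 (by decide))
  have i3 : (tables.run s).arr 3 = I.input.arr 3 :=
    (ft.arr 3 (by decide)).trans (f0.arr 3 (by decide))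
  refine ⟨⟨?_, ?_, ?_, ?_, ?_, ?_, ?_, ?_, ?_, ?_⟩, hcount, ?_, ?_⟩
  · exact (ft.reg 0 (by decide)).trans p0
  · exact (ft.reg 1 (by decide)).trans p1
  · exact (ft.reg 2 (by decide)).trans (f0.reg 2 (by decide))
  · exact (ft.reg 3 (by decide)).trans p3
  · exact (ft.reg 11 (by decide)).trans p11
  · intro i r
    rw [i0, a4 i i.2]
    exact rowMajor_apply I.util i r
  · intro i r
    rw [i1, a4 i i.2]
    simp only [input]
    rw [rowMajor_apply]
    simp
  · intro i j
    rw [i2, a5 i i.2]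
    simp only [input]
    rw [rowMajor_apply]
    simp
  · intro i j
    rw [i3, a5 i i.2]
    simp only [input]
    rw [rowMajor_apply]
    simp
  · rw [a6]; exact hrad
  · exact (ft.reg 5 (by decide)).trans (f0.reg 5 (by decide))
  · intro x
    rw [ft.arr 7 (by decide), f0.arr 7 (by decide)]
    rfl

end Instance

/-! ## Running time -/

/-- The values of the loop bounds. -/
def bounds (n m : ℕ) : ℕ → ℕ
  | 0 => n
  | 1 => m
  | 3 => n + n + n
  | 4 => place n (n + n + n)
  | 11 => m + 1
  | 19 => n + 2
  | _ => 0

theorem Expr.cost_const (c : ℕ) : (Expr.const c).cost = 1 := rfl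

theorem Expr.cost_reg (x : ℕ) : (Expr.reg x).cost = 1 := rfl

theorem Expr.cost_read (a : ℕ) (e : Expr) : (Expr.read a e).cost = e.cost + 1 := rfl

theorem Expr.cost_add (e e' : Expr) : (e + e').cost = e.cost + e'.cost + 1 := rfl

theorem Expr.cost_sub (e e' : Expr) : (e - e').cost = e.cost + e'.cost + 1 := rfl

theorem Expr.cost_entry (a b : ℕ) (i j : Expr) :
    (Expr.entry a b i j).cost = i.cost + j.cost + 3 := by
  simp only [entry, cost_read, cost_add]
  omega

/-- The dominant term comes from `m + 1` rounds that compare `n ^ 2` pairs of agents by summing over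
`m` resources; the constant is generous. -/
theorem config_cost_le (n m : ℕ) :
    config.cost (bounds n m) + 8 ≤ 1000 * ((n + 1) ^ 2 * (m + 1) ^ 2) := by
  simp only [config, decode, revive, rounds, increment, decodeStep, incrementStep, round, choose,
    chooseStep, judge, judgeStep, bundleValue, LProg.cost, Expr.cost_const, Expr.cost_reg,
    Expr.cost_read, Expr.cost_add, Expr.cost_sub, Expr.cost_entry, bounds]
  ring_nf
  nlinarith

theorem tables_cost_le (n m : ℕ) :
    prepare.cost (bounds n m) + tables.cost (bounds n m) + 8 ≤
      1000 * ((n + 1) ^ 2 * (m + 1) ^ 2) := by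
  simp only [prepare, tables, rows, radices, count, multiply, LProg.cost, Expr.cost_const,
    Expr.cost_reg, Expr.cost_read, Expr.cost_add, Expr.cost_sub, bounds]
  ring_nf
  nlinarith

/-! ### The number of digit vectors compared with `(2 * n) ^ n` -/

theorem place_eq_two_pow {n b : ℕ} (hb : b ≤ n + n) : place n b = 2 ^ b := by
  rw [place, Finset.prod_congr rfl (g := fun _ => 2)]
  · simp
  · intro x hx
    rw [Finset.mem_range] at hx
    rw [radix, if_pos (by omega)]

/-- The number of digit vectors. -/
theorem place_eq (n : ℕ) : place n (n + n + n) = 2 ^ n * (2 ^ n * n.factorial) := by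
  -- The last `n` radices are `n, n - 1, …, 1`.
  have key : ∀ b ≤ n, place n (n + n + b) = 2 ^ (n + n) * n.descFactorial b := by
    intro b hb
    induction b with
    | zero => simp [place_eq_two_pow]
    | succ b ih =>
      rw [← add_assoc, place_succ, ih (by omega), Nat.descFactorial_succ, radix,
        if_neg (by omega), show n + n + n - (n + n + b) = n - b by omega]
      ring
  rw [key n le_rfl, Nat.descFactorial_self, pow_add, mul_assoc]

/-- Bernoulli's inequality with exponent `n / 2`, which is at least one, gives `(1 + 1 / n) ^ (n /
2) ≥ 3 / 2`; squaring gives 9/4. What matters is that 9/4 exceeds 2. -/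
theorem nine_mul_pow_self_le {n : ℕ} (hn : 2 ≤ n) : 9 * n ^ n ≤ 4 * (n + 1) ^ n := by
  have hpos : (0 : ℝ) < n := by positivity
  have h2 : (2 : ℝ) ≤ n := by exact_mod_cast hn
  have h := one_add_mul_self_le_rpow_one_add (s := (n : ℝ)⁻¹) (p := n / 2)
    (by have := inv_pos.mpr hpos; linarith) (by linarith)
  have h1 : 1 + (n : ℝ) / 2 * (n : ℝ)⁻¹ = 3 / 2 := by field_simp; norm_num
  rw [h1] at h
  have hsq : ((1 + (n : ℝ)⁻¹) ^ ((n : ℝ) / 2)) ^ 2 = (1 + (n : ℝ)⁻¹) ^ n := by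
    rw [← Real.rpow_natCast, ← Real.rpow_mul (by positivity), ← Real.rpow_natCast]
    congr 1
    push_cast
    ring
  have h9 : (9 / 4 : ℝ) ≤ (1 + (n : ℝ)⁻¹) ^ n := by
    rw [← hsq]
    nlinarith
  have hmul : (1 + (n : ℝ)⁻¹) ^ n * n ^ n = (n + 1) ^ n := by
    rw [← mul_pow]
    congr 1
    field_simp
  have : (9 / 4 : ℝ) * n ^ n ≤ (n + 1) ^ n := by
    rw [← hmul]
    gcongr
  have : (9 : ℝ) * n ^ n ≤ 4 * (n + 1) ^ n := by linarith
  exact_mod_cast this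

/-- From `n` to `n + 1` the quotient `2 ^ n * n! / n ^ n` changes by the factor `2 / (1 + 1 / n) ^
n`, at most 8/9 for `n ≥ 2`. The constant 3 covers `n = 1` and `n = 2`. -/
theorem two_pow_mul_factorial_le {n : ℕ} (hn : 1 ≤ n) :
    2 ^ n * n.factorial * 9 ^ n ≤ 3 * (8 ^ n * n ^ n) := by
  induction n, hn using Nat.le_induction with
  | base => simp
  | succ n hn ih =>
    by_cases h1 : n = 1
    · subst h1; decide
    · have h9 := nine_mul_pow_self_le (n := n) (by omega)
      calc 2 ^ (n + 1) * (n + 1).factorial * 9 ^ (n + 1)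
          = 18 * (n + 1) * (2 ^ n * n.factorial * 9 ^ n) := by
            rw [Nat.factorial_succ]; ring
        _ ≤ 18 * (n + 1) * (3 * (8 ^ n * n ^ n)) := by gcongr
        _ = 6 * (n + 1) * 8 ^ n * (9 * n ^ n) := by ring
        _ ≤ 6 * (n + 1) * 8 ^ n * (4 * (n + 1) ^ n) := by gcongr
        _ = 3 * (8 ^ (n + 1) * (n + 1) ^ (n + 1)) := by ring

/-- The shift by 20 makes consecutive squares grow by at most 9/8 from the start, so the induction
begins at zero with `20 ^ 2 = 400`. -/
theorem sq_mul_eight_pow_le (n : ℕ) : (n + 20) ^ 2 * 8 ^ n ≤ 400 * 9 ^ n := by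
  induction n with
  | zero => simp
  | succ n ih =>
    calc (n + 1 + 20) ^ 2 * 8 ^ (n + 1) = (8 * (n + 21) ^ 2) * 8 ^ n := by ring
      _ ≤ (9 * (n + 20) ^ 2) * 8 ^ n := by gcongr ?_ * _; ring_nf; linarith [Nat.zero_le (n ^ 2)]
      _ = 9 * ((n + 20) ^ 2 * 8 ^ n) := by ring
      _ ≤ 9 * (400 * 9 ^ n) := by gcongr
      _ = 400 * 9 ^ (n + 1) := by ring

/-- The decay `(8 / 9) ^ n` absorbs the quadratic cost in `n`; the constant is `3 * 400`. -/
theorem place_mul_sq_le (n : ℕ) :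
    place n (n + n + n) * (n + 1) ^ 2 ≤ 1200 * (2 * n) ^ n := by
  rcases Nat.eq_zero_or_pos n with rfl | hn
  · simp [place]
  · have key : 2 ^ n * n.factorial * (n + 1) ^ 2 ≤ 1200 * n ^ n := by
      refine Nat.le_of_mul_le_mul_right (c := 9 ^ n) ?_ (by positivity)
      calc 2 ^ n * n.factorial * (n + 1) ^ 2 * 9 ^ n
          = (n + 1) ^ 2 * (2 ^ n * n.factorial * 9 ^ n) := by ring
        _ ≤ (n + 20) ^ 2 * (3 * (8 ^ n * n ^ n)) :=
            Nat.mul_le_mul (Nat.pow_le_pow_left (by omega) 2) (two_pow_mul_factorial_le hn)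
        _ = 3 * n ^ n * ((n + 20) ^ 2 * 8 ^ n) := by ring
        _ ≤ 3 * n ^ n * (400 * 9 ^ n) := Nat.mul_le_mul_left _ (sq_mul_eight_pow_le n)
        _ = 1200 * n ^ n * 9 ^ n := by ring
    rw [place_eq, mul_pow]
    calc 2 ^ n * (2 ^ n * n.factorial) * (n + 1) ^ 2
        = 2 ^ n * (2 ^ n * n.factorial * (n + 1) ^ 2) := by ring
      _ ≤ 2 ^ n * (1200 * n ^ n) := Nat.mul_le_mul_left _ key
      _ = 1200 * (2 ^ n * n ^ n) := by ring

theorem algorithm_solves {n m : ℕ} (I : Instance n m) :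
    ∃ t ≤ 2400000 * (2 * n) ^ n * (m + 1) ^ 2, algorithm.Solves I t := by
  have f0 := frame_run prepare I.input
  have f1 := frame_run tables (prepare.run I.input)
  obtain ⟨hr, h4, h5, h7⟩ := I.ready_tables
  have p3 : (prepare.run I.input).reg 3 = n + n + n := (f1.reg 3 (by decide)).symm.trans hr.regL
  have p0 : (prepare.run I.input).reg 0 = n := (f1.reg 0 (by decide)).symm.trans hr.regN
  have p19 : (prepare.run I.input).reg 19 = n + 2 := by
    simp [prepare, run_seq, run_set, Store.setReg_reg, eval_add, eval_reg, eval_const,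
      Instance.input]
  -- Three stages are needed because a stage must not modify its own loop bounds: each computes
  -- bounds for later ones.
  obtain ⟨t0, ht0, x0⟩ := exec_toProg [] (bounds n m) prepare (by decide) (by simp) I.input
    (by simp)
  obtain ⟨t1, ht1, x1⟩ := exec_toProg [0, 3, 19] (bounds n m) tables (by decide) (by decide)
    (prepare.run I.input) (by simp [bounds, p0, p3, p19])
  obtain ⟨t2, ht2, x2⟩ := exec_toProg [0, 1, 3, 4, 11] (bounds n m) enumerate (by decide)
    (by decide) (tables.run (prepare.run I.input))
    (by simp [bounds, hr.regN, hr.regM, hr.regL, hr.regR, h4])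
  obtain ⟨hy, hn⟩ := hr.enumerate_run h4 h5 h7
  refine ⟨t0 + (t1 + (t2 + 2)), ?_, _, .seq x0 (.seq x1 (.seq x2 (.set _ 0 (.reg 5)))), ?_, ?_⟩
  · have e : enumerate.cost (bounds n m) =
        place n (n + n + n) * (config.cost (bounds n m) + 8) + 6 := rfl
    have hc := Nat.mul_le_mul_left (place n (n + n + n)) (config_cost_le n m)
    have ht := tables_cost_le n m
    have hpos : 1 ≤ place n (n + n + n) := place_pos le_rfl
    -- There is at least one digit vector, so the preparation is charged to the enumeration and only
    -- doubles the constant.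
    have ht' := Nat.mul_le_mul hpos ht
    have hp := Nat.mul_le_mul_right (2000 * (m + 1) ^ 2) (place_mul_sq_le n)
    calc t0 + (t1 + (t2 + 2))
        ≤ place n (n + n + n) * (1000 * ((n + 1) ^ 2 * (m + 1) ^ 2)) +
          place n (n + n + n) * (1000 * ((n + 1) ^ 2 * (m + 1) ^ 2)) := by omega
      _ = place n (n + n + n) * (n + 1) ^ 2 * (2000 * (m + 1) ^ 2) := by ring
      _ ≤ 1200 * (2 * n) ^ n * (2000 * (m + 1) ^ 2) := hp
      _ = 2400000 * (2 * n) ^ n * (m + 1) ^ 2 := by ring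
  · intro h
    simpa [Store.setReg_reg, eval_reg] using hy h
  · intro h
    simpa [Store.setReg_reg, eval_reg] using hn h

theorem computable_bound : Computable fun n : ℕ => 2400000 * (2 * n) ^ n := by
  have hpow : Primrec₂ ((· ^ ·) : ℕ → ℕ → ℕ) := Primrec₂.unpaired'.mp Nat.Primrec.pow
  exact (Primrec.nat_mul.comp (Primrec.const _)
    (hpow.comp (Primrec.nat_mul.comp (Primrec.const 2) Primrec.id) Primrec.id)).to_comp

namespace Instance

theorem agents_pos {n m : ℕ} (I : Instance n m) (hm : 1 ≤ m) : 1 ≤ n := by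
  obtain ⟨i, -⟩ := I.alloc_complete ⟨0, hm⟩
  exact i.pos

/-- The allocation matrix alone takes `n * m` bits, and `n` is positive as soon as a resource needs
an owner. -/
theorem succ_le_size {n m : ℕ} (I : Instance n m) : m + 1 ≤ I.size := by
  have : m ≤ n * m := by
    rcases Nat.eq_zero_or_pos m with rfl | hm
    · simp
    · exact Nat.le_mul_of_pos_left m (I.agents_pos hm)
  unfold size
  omega

end Instance

end ERSA

theorem mainTheorem2 :
    ∃ p : ERSA.Prog,
      (∃ c : ℕ, ∀ (n m : ℕ) (I : ERSA.Instance n m),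
        ∃ t : ℕ, p.Solves I t ∧ (1 ≤ m → t ≤ c * ((2 * n) ^ n * m ^ 2))) ∧
      (∃ (f : ℕ → ℕ) (d : ℕ), Computable f ∧ ∀ (n m : ℕ) (I : ERSA.Instance n m),
        ∃ t : ℕ, p.Solves I t ∧ t ≤ f n * I.size ^ d) := by
  refine ⟨ERSA.algorithm, ⟨9600000, fun n m I => ?_⟩,
    fun n => 2400000 * (2 * n) ^ n, 2, ERSA.computable_bound, fun n m I => ?_⟩
  · obtain ⟨t, ht, hs⟩ := ERSA.algorithm_solves I
    refine ⟨t, hs, fun hm => ht.trans ?_⟩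
    -- Since `m ≥ 1`, `m + 1 ≤ 2 * m`, which costs a factor 4.
    calc 2400000 * (2 * n) ^ n * (m + 1) ^ 2
        ≤ 2400000 * (2 * n) ^ n * (2 * m) ^ 2 :=
          Nat.mul_le_mul_left _ (Nat.pow_le_pow_left (by omega) 2)
      _ = 9600000 * ((2 * n) ^ n * m ^ 2) := by ring
  · obtain ⟨t, ht, hs⟩ := ERSA.algorithm_solves I
    exact ⟨t, hs, ht.trans (Nat.mul_le_mul_left _ (Nat.pow_le_pow_left I.succ_le_size 2))⟩
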